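/- Let $H$ be a finite hypergraph, with a finite vertex set $V(H)$ and a finite set $E(H)$ of edges, each edge being a subset of $V(H)$ (no repeated edges). $H$ is connected if it has a vertex and any two vertices are joined by a walk in which consecutive vertices lie in a common edge; it is $(d,r)$-regular, with $r\ge 2$, if each vertex lies in exactly $d$ edges and each edge has exactly $r$ vertices. The spectrum of $H$ is the multiset of eigenvalues of its adjacency matrix $A(H)$, whose $(u,v)$ entry is the number of edges containing both $u$ and $v$ for $u\neq v$, and $0$ for $u=v$. A connected $(d,r)$-regular hypergraph is right-sided Ramanujan if each of its eigenvalues $\lambda\neq d(r-1)$ satisfies $$\lambda\le r-2+2\sqrt{(d-1)(r-1)}.\qquad (*)$$ A hypergraph $\bar H$ is a $2$-cover of $H$ if there is a surjection $\pi:V(\bar H)\to V(H)$ that maps each edge of $\bar H$ bijectively onto an edge of $H$, induces for each $\bar v\in V(\bar H)$ a bijection from the edges of $\bar H$ containing $\bar v$ to the edges of $H$ containing $\pi(\bar v)$, and is such that each vertex and each edge of $H$ has exactly two preimages. A $2$-cover $\bar H$ of a connected $(d,r)$-regular hypergraph $H$ is a right-sided Ramanujan $2$-cover of $H$ if, as multisets,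 the spectrum of $\bar H$ contains that of $H$ and all new eigenvalues (the spectrum of $\bar H$ minus the spectrum of $H$) satisfy $(*)$. **Theorem.** 1. For every integer $d\ge 3$ there is an infinite sequence $H_0,H_1,H_2,\dots$ of $(d,d)$-regular right-sided Ramanujan hypergraphs such that $H_0$ is the complete $d$-uniform hypergraph on $d+1$ vertices and, for all $i\ge 0$, $H_{i+1}$ is a right-sided Ramanujan $2$-cover of $H_i$; in particular $|V(H_i)|=2^i(d+1)$, so the $H_i$ are pairwise non-isomorphic. 2. For every prime power $d$ there is an infinite sequence $H_0,H_1,H_2,\dots$ of $(d+1,d)$-regular right-sided Ramanujan hypergraphs such that $H_0$ is the affine plane $AG(2,d)$ over the field $\mathbb F_d$ with $d$ elements (vertices the points of $\mathbb F_d^2$, edges the lines) and, for all $i\ge 0$, $H_{i+1}$ is a right-sided Ramanujan $2$-cover of $H_i$; in particular $|V(H_i)|=2^i d^2$, so the $H_i$ are pairwise non-isomorphic. -/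

import Mathlib

noncomputable section

/-- A finite hypergraph: a finite type `V` of vertices together with a hypergraph whose vertex set
is all of `V`. Edges are sets of vertices (there are no repeated edges). -/
structure FinHypergraph where
  V : Type
  [fintypeV : Fintype V]
  toHypergraph : Hypergraph V
  vertexSet_eq : toHypergraph.vertexSet = Set.univ

namespace FinHypergraph

attribute [instance] FinHypergraph.fintypeV

/-- The finite hypergraph on `V` with a given set of edges. -/
def ofEdges (V : Type) [Fintype V] (E : Set (Set V)) : FinHypergraph where
  V := V
  toHypergraph :=
    { vertexSet := Set.univ
      edgeSet := E
      subset_vertexSet_of_mem_edgeSet' := fun e _ => Set.subset_univ e }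
  vertexSet_eq := rfl

/-- The set of edges. -/
def edges (H : FinHypergraph) : Set (Set H.V) := H.toHypergraph.edgeSet

/-- The edges containing a given vertex. -/
def edgesAt (H : FinHypergraph) (v : H.V) : Set (Set H.V) := {e ∈ H.edges | v ∈ e}

open Classical in
/-- The adjacency matrix: the `(u, v)` entry is the number of edges containing both `u` and `v`
if `u ≠ v`, and `0` if `u = v`. -/
def adjMatrix (H : FinHypergraph) : Matrix H.V H.V ℝ :=
  Matrix.of fun u v =>
    if u = v then 0 else (({e ∈ H.edges | u ∈ e ∧ v ∈ e} : Set (Set H.V)).ncard : ℝ)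

open Classical in
/-- The spectrum: the multiset of eigenvalues (with multiplicity) of the adjacency matrix.
This matrix is real symmetric, so all roots of its characteristic polynomial are real. -/
def spectrum (H : FinHypergraph) : Multiset ℝ :=
  H.adjMatrix.charpoly.roots

/-- `(d, r)`-regular: `r ≥ 2`, every vertex lies in exactly `d` edges, every edge has exactly `r`
vertices. -/
def IsRegular (H : FinHypergraph) (d r : ℕ) : Prop :=
  2 ≤ r ∧ (∀ v : H.V, (H.edgesAt v).ncard = d) ∧ ∀ e ∈ H.edges, e.ncard = r

/-- Connected: nonempty, and any two vertices are joined by a walk, consecutive vertices of which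
lie in a common edge. -/
def IsConnected (H : FinHypergraph) : Prop :=
  Nonempty H.V ∧ ∀ u v : H.V, Relation.ReflTransGen H.toHypergraph.Adj u v

/-- The right-sided Ramanujan bound `r - 2 + 2 √((d - 1)(r - 1))`. -/
def ramanujanBound (d r : ℕ) : ℝ :=
  (r : ℝ) - 2 + 2 * Real.sqrt (((d : ℝ) - 1) * ((r : ℝ) - 1))

/-- A right-sided Ramanujan `(d, r)`-regular hypergraph: connected, `(d, r)`-regular, and every
eigenvalue other than the trivial one `d (r - 1)` is at most the Ramanujan bound. -/
def IsRightSidedRamanujan (H : FinHypergraph) (d r : ℕ) : Prop :=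
  H.IsConnected ∧ H.IsRegular d r ∧
    ∀ l ∈ H.spectrum, l ≠ (d : ℝ) * ((r : ℝ) - 1) → l ≤ ramanujanBound d r

/-- A covering projection from `K` to `H`: a surjection on vertices which maps each edge
bijectively onto an edge, and which maps the edges containing a vertex `v` bijectively to the
edges containing the image of `v`. -/
structure IsCoveringProjection (K H : FinHypergraph) (p : K.V → H.V) : Prop where
  surjective : Function.Surjective p
  map_edge : ∀ e ∈ K.edges, p '' e ∈ H.edges
  injOn_edge : ∀ e ∈ K.edges, Set.InjOn p e
  bijOn_edgesAt : ∀ v : K.V, Set.BijOn (fun e => p '' e) (K.edgesAt v) (H.edgesAt (p v))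

/-- `K` is a `k`-cover of `H`: there is a covering projection for which every vertex and every
edge of `H` has exactly `k` preimages. -/
def IsCover (k : ℕ) (K H : FinHypergraph) : Prop :=
  ∃ p : K.V → H.V, IsCoveringProjection K H p ∧
    (∀ v : H.V, ({w | p w = v} : Set K.V).ncard = k) ∧
    ∀ e ∈ H.edges, ({f ∈ K.edges | p '' f = e} : Set (Set K.V)).ncard = k

/-- The new eigenvalues of a cover `K` of `H`: the spectrum of `K` with the spectrum of `H`
removed, as multisets. -/
def newEigenvalues (K H : FinHypergraph) : Multiset ℝ :=
  K.spectrum - H.spectrum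

/-- `K` is a right-sided Ramanujan `2`-covering of the connected `(d, r)`-regular
hypergraph `H`: it is a `2`-cover, its spectrum contains that of `H`, and all new eigenvalues are
at most the Ramanujan bound. -/
def IsRightSidedRamanujanTwoCover (K H : FinHypergraph) (d r : ℕ) : Prop :=
  H.IsConnected ∧ H.IsRegular d r ∧ IsCover 2 K H ∧ H.spectrum ≤ K.spectrum ∧
    ∀ l ∈ newEigenvalues K H, l ≤ ramanujanBound d r

/-- The complete `d`-uniform hypergraph on `d + 1` vertices. -/
def complete (d : ℕ) : FinHypergraph :=
  ofEdges (Fin (d + 1)) {e | e.ncard = d}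

/-- The affine plane over a finite field `F`: vertices are the pairs `(x, y)`, and edges are the
lines `a x + b y = c` with `(a, b) ≠ (0, 0)`. -/
def affinePlane (F : Type) [Field F] [Fintype F] : FinHypergraph :=
  ofEdges (F × F) {L | ∃ a b c : F, (a ≠ 0 ∨ b ≠ 0) ∧ L = {x : F × F | a * x.1 + b * x.2 = c}}

end FinHypergraph

end

/-! A choice of signs on the incidences (vertex, edge) of `H` defines a 2-lift. Its spectrum is that
of `H` together with that of the signed adjacency matrix, which equals `N * Nᵀ - d` for the signed
incidence matrix `N`. Since `(√(d-1) + √(r-1))² - d = r - 2 + 2√((d-1)(r-1))`, it suffices to find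
signs for which all singular values of `N` are at most `√(d-1) + √(r-1)`. These singular values are
the nonnegative eigenvalues of a signing of the bipartite incidence graph, so the method of Marcus,
Spielman and Srivastava applies.

Averaged over all signings, the characteristic polynomial of a graph is its matching polynomial
(Godsil and Gutman). A weighted Heilmann-Lieb argument shows that the latter is positive to the
right of `√(d-1) + √(r-1)` (`edgeOps_matching_pos`). The signs are then fixed one edge at a time.
Averaging over the sign of an edge `uv` acts on principal minors as `1 - ∂_u ∂_v` (`edgeOp`), which
preserves stability, so the partially averaged polynomials for the two signs have a common
interlacer: the one with the vertex `u` deleted. Hence one of the two signs does not push the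
largest root to the right (`pos_or_pos_of_add_pos`, `exists_signs_of_edgeOps_pos`).

If the lift were disconnected, `N * Nᵀ` would have the eigenvalue `d * r`. This exceeds the bound
unless `d = r = 2`, so connectedness persists and the construction iterates. The starting
hypergraphs are 2-designs, whose only nontrivial eigenvalue is negative. -/

noncomputable section

/-! ### Averaging over the sign of an edge, and the matching recursion -/

section EdgeOperator

variable {W : Type*} [DecidableEq W] {M : Type*} [AddCommGroup M]

/-- The operator on functions of vertex sets which adds `e` to the edges that a matching may use:
it turns `f T` into `f T - f (T \ e)` whenever both ends of `e` lie in `T`. -/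
def edgeOp (e : W × W) (f : Finset W → M) (T : Finset W) : M :=
  if e.1 ∈ T ∧ e.2 ∈ T then f T - f ((T.erase e.1).erase e.2) else f T

/-- The edge operators of a list of edges, the head of the list being applied first. -/
def edgeOps (l : List (W × W)) (f : Finset W → M) : Finset W → M :=
  l.foldl (fun g e => edgeOp e g) f

@[simp] theorem edgeOps_nil (f : Finset W → M) : edgeOps [] f = f := rfl

@[simp] theorem edgeOps_cons (e : W × W) (l : List (W × W)) (f : Finset W → M) :
    edgeOps (e :: l) f = edgeOps l (edgeOp e f) := rfl

theorem edgeOps_append_singleton (e : W × W) (l : List (W × W)) (f : Finset W → M) :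
    edgeOps (l ++ [e]) f = edgeOp e (edgeOps l f) := by
  simp [edgeOps]

theorem edgeOp_map {N : Type*} [AddCommGroup N] (φ : M →+ N) (e : W × W) (f : Finset W → M) :
    edgeOp e (fun T => φ (f T)) = fun T => φ (edgeOp e f T) := by
  funext T
  simp only [edgeOp]
  split_ifs <;> simp

theorem edgeOps_map {N : Type*} [AddCommGroup N] (φ : M →+ N) (l : List (W × W))
    (f : Finset W → M) : edgeOps l (fun T => φ (f T)) = fun T => φ (edgeOps l f T) := by
  induction l generalizing f with
  | nil => rfl
  | cons e l ih => rw [edgeOps_cons, edgeOps_cons, edgeOp_map, ih]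

theorem edgeOp_add (e : W × W) (f g : Finset W → M) :
    edgeOp e (f + g) = edgeOp e f + edgeOp e g := by
  funext T
  simp only [edgeOp, Pi.add_apply]
  split_ifs <;> abel

theorem edgeOps_add (l : List (W × W)) (f g : Finset W → M) :
    edgeOps l (f + g) = edgeOps l f + edgeOps l g := by
  induction l generalizing f g with
  | nil => rfl
  | cons e l ih => rw [edgeOps_cons, edgeOps_cons, edgeOps_cons, edgeOp_add, ih]

theorem edgeOps_empty (l : List (W × W)) (f : Finset W → M) : edgeOps l f ∅ = f ∅ := by
  induction l generalizing f with
  | nil => rfl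
  | cons e l ih => rw [edgeOps_cons, ih, edgeOp, if_neg (by simp)]

/-- The operators only ever pass from a set to its subsets. This is what makes the polynomial with a
vertex deleted independent of the sign of an edge at that vertex. -/
theorem edgeOps_congr (l : List (W × W)) {f g : Finset W → M} {T : Finset W}
    (h : ∀ S ⊆ T, f S = g S) : edgeOps l f T = edgeOps l g T := by
  induction l generalizing f g with
  | nil => exact h T subset_rfl
  | cons e l ih =>
    refine ih fun S hS => ?_
    have h1 := h _ (((Finset.erase_subset e.2 (S.erase e.1)).trans (Finset.erase_subset _ _)).trans hS)
    simp only [edgeOp, h S hS, h1]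

/-- The recursion of the matching polynomial at the vertex `u`. -/
theorem edgeOps_matching_recursion {R : Type*} [CommRing R] (c : W → R) (l : List (W × W))
    (hl : ∀ e ∈ l, e.1 ≠ e.2) (T : Finset W) (u : W) (hu : u ∈ T) :
    edgeOps l (fun T => ∏ v ∈ T, c v) T = c u * edgeOps l (fun T => ∏ v ∈ T, c v) (T.erase u) -
      (l.map fun e => if (e.1 = u ∨ e.2 = u) ∧ e.1 ∈ T ∧ e.2 ∈ T then
        edgeOps l (fun T => ∏ v ∈ T, c v) ((T.erase e.1).erase e.2) else 0).sum := by
  -- Induction from the end of the list, so that the operator of the new edge `e` is the outermost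
  -- one.
  induction l using List.reverseRecOn generalizing T with
  | nil => simp [Finset.mul_prod_erase T c hu]
  | append_singleton l e ih =>
    have hl' : ∀ e ∈ l, e.1 ≠ e.2 := fun e he => hl e (by simp [he])
    have he : e.1 ≠ e.2 := hl e (by simp)
    rw [edgeOps_append_singleton]
    set m := edgeOps l (fun T => ∏ v ∈ T, c v) with hm
    rw [List.map_append, List.sum_append]
    simp only [List.map_cons, List.map_nil, List.sum_cons, List.sum_nil, add_zero]
    -- If `e` meets `u`, its operator does nothing on sets without `u`, and only the summand of `e`
    -- itself is new. Otherwise the recursion for `T` minus the recursion for `T \ e` is the claim.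
    by_cases hue : e.1 = u ∨ e.2 = u
    · have h0 : ∀ S : Finset W, u ∉ S → edgeOp e m S = m S := by
        intro S hS
        rw [edgeOp, if_neg]
        rintro ⟨h1, h2⟩
        rcases hue with h | h <;> subst h <;> contradiction
      rw [h0 (T.erase u) (by simp)]
      have h1 : ∀ f ∈ l, (if (f.1 = u ∨ f.2 = u) ∧ f.1 ∈ T ∧ f.2 ∈ T then
          edgeOp e m ((T.erase f.1).erase f.2) else 0) =
          (if (f.1 = u ∨ f.2 = u) ∧ f.1 ∈ T ∧ f.2 ∈ T then
          m ((T.erase f.1).erase f.2) else 0) := by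
        intro f _
        split_ifs with h
        · apply h0
          rcases h.1 with h | h <;> simp [h]
        · rfl
      rw [List.map_congr_left h1, sub_add_eq_sub_sub, ← ih hl' T hu]
      rw [h0 ((T.erase e.1).erase e.2) (by rcases hue with h | h <;> simp [h])]
      simp only [edgeOp, hue, true_and]
      split_ifs <;> simp
    · rw [if_neg (by tauto), add_zero]
      push Not at hue
      by_cases heT : e.1 ∈ T ∧ e.2 ∈ T
      · have h1 : ∀ f ∈ l, (if (f.1 = u ∨ f.2 = u) ∧ f.1 ∈ T ∧ f.2 ∈ T then
            edgeOp e m ((T.erase f.1).erase f.2) else 0) =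
            (if (f.1 = u ∨ f.2 = u) ∧ f.1 ∈ T ∧ f.2 ∈ T then
              m ((T.erase f.1).erase f.2) else 0) -
            (if (f.1 = u ∨ f.2 = u) ∧ f.1 ∈ (T.erase e.1).erase e.2 ∧
              f.2 ∈ (T.erase e.1).erase e.2 then
              m ((((T.erase e.1).erase e.2).erase f.1).erase f.2) else 0) := by
          intro f _
          by_cases hf : (f.1 = u ∨ f.2 = u) ∧ f.1 ∈ T ∧ f.2 ∈ T
          · rw [if_pos hf, if_pos hf]
            by_cases hef : e.1 ∈ (T.erase f.1).erase f.2 ∧ e.2 ∈ (T.erase f.1).erase f.2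
            · rw [edgeOp, if_pos hef, if_pos]
              · congr 2
                ext w; simp only [Finset.mem_erase]; tauto
              · simp only [Finset.mem_erase] at hef ⊢
                tauto
            · rw [edgeOp, if_neg hef, if_neg, sub_zero]
              simp only [Finset.mem_erase] at hef ⊢
              tauto
          · rw [if_neg hf, if_neg hf, if_neg, sub_zero]
            simp only [Finset.mem_erase]
            tauto
        have huT : u ∈ (T.erase e.1).erase e.2 := by
          simp [hu, Ne.symm hue.1, Ne.symm hue.2]
        have h2 : edgeOp e m (T.erase u) =
            m (T.erase u) - m (((T.erase e.1).erase e.2).erase u) := by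
          rw [edgeOp, if_pos (by simp [heT, hue])]
          congr 2
          ext w; simp only [Finset.mem_erase]; tauto
        have h3 : ∀ (g h : W × W → R), (l.map fun e => g e - h e).sum =
            (l.map g).sum - (l.map h).sum := by
          intro g h
          clear * -
          induction l with
          | nil => simp
          | cons a l ih => simp only [List.map_cons, List.sum_cons, ih]; ring
        rw [List.map_congr_left h1, h3, h2, edgeOp, if_pos heT, ih hl' T hu, ih hl' _ huT]
        ring
      · have h1 : ∀ S ⊆ T, edgeOp e m S = m S := by
          intro S hS
          rw [edgeOp, if_neg (fun h => heT ⟨hS h.1, hS h.2⟩)]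
        have h2 : ∀ f ∈ l, (if (f.1 = u ∨ f.2 = u) ∧ f.1 ∈ T ∧ f.2 ∈ T then
            edgeOp e m ((T.erase f.1).erase f.2) else 0) =
            (if (f.1 = u ∨ f.2 = u) ∧ f.1 ∈ T ∧ f.2 ∈ T then
            m ((T.erase f.1).erase f.2) else 0) := by
          intro f _
          rw [h1 _ ((Finset.erase_subset _ _).trans (Finset.erase_subset _ _))]
        rw [List.map_congr_left h2, h1 T subset_rfl, h1 _ (Finset.erase_subset _ _)]
        exact ih hl' T hu

end EdgeOperator
end

/-! ### The Heilmann-Lieb bound -/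

noncomputable section

section MatchingBound

variable {W : Type*} [DecidableEq W]

/-- The Heilmann-Lieb bound: if `u` has at most `a u ^ 2 + 1` edges for each vertex `u` and
`a u + a v < x` for each edge `u v`, then the matching polynomial is positive at `x`. -/
theorem edgeOps_matching_pos (s : Finset (W × W)) (hs : ∀ e ∈ s, e.1 ≠ e.2) (a : W → ℝ)
    (ha : ∀ u, 0 < a u) (x : ℝ) (hx : 0 < x) (hax : ∀ e ∈ s, a e.1 + a e.2 < x)
    (haa : ∀ e ∈ s, 1 ≤ a e.1 * a e.2)
    (hdeg : ∀ u, ((s.filter fun e => e.1 = u ∨ e.2 = u).card : ℝ) ≤ a u ^ 2 + 1)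
    (T : Finset W) : 0 < edgeOps s.toList (fun T => ∏ _v ∈ T, x) T := by
  set m := edgeOps s.toList (fun T => ∏ _v ∈ T, x) with hm
  have hrec : ∀ (T : Finset W) (u : W), u ∈ T → m T = x * m (T.erase u) -
      ∑ e ∈ s with (e.1 = u ∨ e.2 = u) ∧ e.1 ∈ T ∧ e.2 ∈ T, m ((T.erase e.1).erase e.2) := by
    intro T u hu
    have := edgeOps_matching_recursion (fun _ => x) s.toList (by simpa using hs) T u hu
    rw [Finset.sum_filter]
    rw [Finset.sum_map_toList] at this
    exact this
  -- The ratio `m T / m (T.erase u)` is at least `x - a u` as soon as `u` has lost an edge, for then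
  -- at most `a u ^ 2` edges remain at `u`. Positivity alone would not carry the induction.
  have main : ∀ (n : ℕ) (T : Finset W), T.card = n → 0 < m T ∧
      ∀ u ∈ T, (∃ e ∈ s, (e.1 = u ∨ e.2 = u) ∧ ¬ (e.1 ∈ T ∧ e.2 ∈ T)) →
        (x - a u) * m (T.erase u) ≤ m T := by
    intro n
    induction n with
    | zero =>
      intro T hT
      rw [Finset.card_eq_zero] at hT
      subst hT
      refine ⟨?_, by simp⟩
      rw [hm, edgeOps_empty, Finset.prod_empty]
      exact one_pos
    | succ n ih =>
      intro T hT
      -- Deleting `u` costs its neighbour `v` the edge `uv`, so the induction hypothesis applies to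
      -- `v` in `T.erase u`, and `x - a v > a u`.
      have hmono : ∀ u ∈ T, ∀ e ∈ s, (e.1 = u ∨ e.2 = u) → e.1 ∈ T → e.2 ∈ T →
          m ((T.erase e.1).erase e.2) ≤ (a u)⁻¹ * m (T.erase u) := by
        intro u hu e he hue h1 h2
        have hc : (T.erase u).card = n := by rw [Finset.card_erase_of_mem hu, hT]; rfl
        have hne := hs e he
        have h3 := hax e he
        obtain ⟨hp, hq⟩ := ih (T.erase u) hc
        rcases hue with rfl | rfl
        · have h4 := hq e.2 (by simp [h2, hne.symm]) ⟨e, he, by simp⟩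
          rw [← div_eq_inv_mul, le_div_iff₀ (ha _)]
          rcases le_total 0 (m ((T.erase e.1).erase e.2)) with h | h
          · nlinarith
          · nlinarith [ha e.1]
        · have h4 := hq e.1 (by simp [h1, hne]) ⟨e, he, by simp⟩
          rw [Finset.erase_right_comm]
          rw [← div_eq_inv_mul, le_div_iff₀ (ha _)]
          rcases le_total 0 (m ((T.erase e.2).erase e.1)) with h | h
          · nlinarith
          · nlinarith [ha e.2]
      have hlow : ∀ u ∈ T, (x - ((s.filter fun e => (e.1 = u ∨ e.2 = u) ∧ e.1 ∈ T ∧ e.2 ∈ T).card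
          : ℝ) * (a u)⁻¹) * m (T.erase u) ≤ m T := by
        intro u hu
        rw [hrec T u hu, sub_mul]
        have := Finset.sum_le_card_nsmul
          (s.filter fun e => (e.1 = u ∨ e.2 = u) ∧ e.1 ∈ T ∧ e.2 ∈ T)
          (fun e => m ((T.erase e.1).erase e.2)) ((a u)⁻¹ * m (T.erase u)) (by
            intro e he
            rw [Finset.mem_filter] at he
            exact hmono u hu e he.1 he.2.1 he.2.2.1 he.2.2.2)
        rw [nsmul_eq_mul, ← mul_assoc] at this
        linarith
      have herase : ∀ u ∈ T, 0 < m (T.erase u) := fun u hu =>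
        (ih (T.erase u) (by rw [Finset.card_erase_of_mem hu, hT]; rfl)).1
      constructor
      · obtain ⟨u, hu⟩ : T.Nonempty := by
          rw [← Finset.card_pos, hT]; exact Nat.succ_pos n
        refine lt_of_lt_of_le (mul_pos ?_ (herase u hu)) (hlow u hu)
        -- At full degree the loss is at most `a u + 1 / a u ≤ a u + a v < x` for any neighbour `v`,
        -- by `haa` and `hax`.
        rw [sub_pos, ← div_eq_mul_inv, div_lt_iff₀ (ha u)]
        rcases (s.filter fun e => (e.1 = u ∨ e.2 = u) ∧ e.1 ∈ T ∧ e.2 ∈ T).eq_empty_or_nonempty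
          with h | ⟨e, he⟩
        · rw [h]
          simpa using mul_pos hx (ha u)
        · rw [Finset.mem_filter] at he
          have h1 : ((s.filter fun e => (e.1 = u ∨ e.2 = u) ∧ e.1 ∈ T ∧ e.2 ∈ T).card : ℝ) ≤
              a u ^ 2 + 1 := by
            refine le_trans ?_ (hdeg u)
            exact_mod_cast Finset.card_le_card
              (Finset.monotone_filter_right _ fun _ _ h => And.left h)
          have h2 := hax e he.1
          have h3 := haa e he.1
          have h4 := ha u
          rcases he.2.1 with h | h <;> rw [h] at h2 h3 <;> nlinarith
      · rintro u hu ⟨e, he, hue, heT⟩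
        refine le_trans (mul_le_mul_of_nonneg_right ?_ (herase u hu).le) (hlow u hu)
        rw [sub_le_sub_iff_left, ← div_eq_mul_inv, div_le_iff₀ (ha u)]
        have h1 : (s.filter fun e => (e.1 = u ∨ e.2 = u) ∧ e.1 ∈ T ∧ e.2 ∈ T).card + 1 ≤
            (s.filter fun e => (e.1 = u ∨ e.2 = u)).card := by
          apply Finset.card_lt_card
          rw [Finset.ssubset_iff_of_subset
            (Finset.monotone_filter_right _ fun _ _ h => And.left h)]
          exact ⟨e, by simp [he, hue], by simp only [Finset.mem_filter]; tauto⟩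
        have h2 := hdeg u
        have h3 : ((s.filter fun e => (e.1 = u ∨ e.2 = u) ∧ e.1 ∈ T ∧ e.2 ∈ T).card : ℝ) + 1 ≤
            (s.filter fun e => (e.1 = u ∨ e.2 = u)).card := by exact_mod_cast h1
        nlinarith
  exact (main _ T rfl).1

end MatchingBound

/-! ### Stable families of multiaffine polynomials -/

section Stability

variable {W : Type*} [DecidableEq W]

open Function

/-- A family of multiaffine polynomial functions indexed by sets of variables, such that the
coefficient of `x u` in `f T` is `f (T.erase u)`, and which do not vanish when all variables lie in
the open upper half plane. -/
structure IsStableFamily (f : Finset W → (W → ℂ) → ℂ) : Prop where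
  affine : ∀ T, ∀ u ∈ T, ∀ x z, f T (update x u z) = f T x + (z - x u) * f (T.erase u) x
  indep : ∀ T, ∀ u ∉ T, ∀ x z, f T (update x u z) = f T x
  ne_zero : ∀ T x, (∀ v, 0 < (x v).im) → f T x ≠ 0

/-- As a function of the variable at `u` alone, `f T` is affine with slope `f (T.erase u)`. Its zero
`x u - f T x / f (T.erase u) x` cannot lie in the upper half plane. -/
theorem IsStableFamily.im_le_im_div {f : Finset W → (W → ℂ) → ℂ} (hf : IsStableFamily f)
    {T : Finset W} {u : W} (hu : u ∈ T) {x : W → ℂ} (hx : ∀ v, 0 < (x v).im) :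
    (x u).im ≤ (f T x / f (T.erase u) x).im := by
  by_contra! h
  have hQ := hf.ne_zero (T.erase u) x hx
  have h1 := hf.affine T u hu x (x u - f T x / f (T.erase u) x)
  refine hf.ne_zero T (update x u (x u - f T x / f (T.erase u) x)) ?_ ?_
  · intro v
    by_cases hv : v = u
    · subst hv
      simpa using h
    · rw [update_of_ne hv]
      exact hx v
  · rw [h1]
    field_simp
    ring

theorem IsStableFamily.edgeOp {f : Finset W → (W → ℂ) → ℂ} (hf : IsStableFamily f) (e : W × W)
    (he : e.1 ≠ e.2) : IsStableFamily (edgeOp e f) where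
  affine := by
    intro T w hw x z
    by_cases heT : e.1 ∈ T ∧ e.2 ∈ T
    · by_cases hwe : w = e.1 ∨ w = e.2
      · have h1 : ¬ (e.1 ∈ T.erase w ∧ e.2 ∈ T.erase w) := by
          rcases hwe with h | h <;> simp [h]
        rw [_root_.edgeOp, if_pos heT, _root_.edgeOp, if_neg h1, Pi.sub_apply, Pi.sub_apply,
          hf.affine T w hw, hf.indep ((T.erase e.1).erase e.2) w
            (by rcases hwe with h | h <;> simp [h])]
        ring
      · push Not at hwe
        have h1 : e.1 ∈ T.erase w ∧ e.2 ∈ T.erase w := by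
          simp [heT, hwe.1.symm, hwe.2.symm]
        have h2 : ((T.erase w).erase e.1).erase e.2 = ((T.erase e.1).erase e.2).erase w := by
          ext; simp only [Finset.mem_erase]; tauto
        rw [_root_.edgeOp, if_pos heT, _root_.edgeOp, if_pos h1, Pi.sub_apply, Pi.sub_apply,
          Pi.sub_apply, hf.affine T w hw, hf.affine ((T.erase e.1).erase e.2) w (by simp [hw, hwe]),
          h2]
        ring
    · have h1 : ¬ (e.1 ∈ T.erase w ∧ e.2 ∈ T.erase w) := by
        simp only [Finset.mem_erase]; tauto
      rw [_root_.edgeOp, if_neg heT, _root_.edgeOp, if_neg h1, hf.affine T w hw]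
  indep := by
    intro T w hw x z
    unfold _root_.edgeOp
    split_ifs
    · rw [Pi.sub_apply, Pi.sub_apply, hf.indep T w hw,
        hf.indep _ w (by simp [hw])]
    · exact hf.indep T w hw x z
  ne_zero := by
    intro T x hx
    unfold _root_.edgeOp
    split_ifs with heT
    -- A zero would make the ratios `f T / f (T.erase e.1)` and `f (T.erase e.1) / f (T \ e)`
    -- mutually inverse. Both have positive imaginary part, whereas inversion reverses its sign.
    · intro h
      rw [Pi.sub_apply, sub_eq_zero] at h
      have h1 := hf.im_le_im_div heT.1 hx
      have h2 := hf.im_le_im_div (T := T.erase e.1) (u := e.2) (by simp [heT, he.symm]) hx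
      have h3 : (f T x / f (T.erase e.1) x) =
          (f (T.erase e.1) x / f ((T.erase e.1).erase e.2) x)⁻¹ := by
        rw [h, inv_div]
      rw [h3, Complex.inv_im] at h1
      have h4 : -(f (T.erase e.1) x / f ((T.erase e.1).erase e.2) x).im /
        Complex.normSq (f (T.erase e.1) x / f ((T.erase e.1).erase e.2) x) ≤ 0 :=
        div_nonpos_of_nonpos_of_nonneg (by linarith [hx e.2]) (Complex.normSq_nonneg _)
      linarith [hx e.1]
    · exact hf.ne_zero T x hx

theorem IsStableFamily.edgeOps {l : List (W × W)} {f : Finset W → (W → ℂ) → ℂ}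
    (hf : IsStableFamily f) (hl : ∀ e ∈ l, e.1 ≠ e.2) : IsStableFamily (edgeOps l f) := by
  induction l generalizing f with
  | nil => exact hf
  | cons e l ih =>
    exact ih (hf.edgeOp e (hl e (by simp))) (fun e' he' => hl e' (by simp [he']))

end Stability
end

/-! ### Interlacing of real polynomials -/

noncomputable section

section Interlacing

open Polynomial

/-- `P / Q` maps the upper half plane into itself, and even raises imaginary parts. -/
def IsNevanlinnaPair (P Q : ℝ[X]) : Prop :=
  ∀ z : ℂ, 0 < z.im → aeval z Q ≠ 0 ∧ z.im ≤ (aeval z P / aeval z Q).im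

namespace IsNevanlinnaPair

variable {P Q : ℝ[X]}

/-- On `z = x + t * I` the hypothesis reads `0 ≤ Im P * Re Q - Re P * Im Q - t * |Q|²` for `t > 0`.
The right side vanishes at `t = 0`, so its derivative there, the Wronskian minus `Q(x)²`, is
nonnegative. Roots of `Q` need no separate treatment. -/
theorem sq_le_wronskian (h : IsNevanlinnaPair P Q) (x : ℝ) :
    (Q.eval x) ^ 2 ≤ P.derivative.eval x * Q.eval x - P.eval x * Q.derivative.eval x := by
  have hline : HasDerivAt (fun t : ℝ => (x : ℂ) + t * Complex.I) Complex.I 0 := by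
    have h1 := (Complex.ofRealCLM.hasDerivAt (x := (0 : ℝ))).mul_const Complex.I
    simpa using h1.const_add (x : ℂ)
  have hd : ∀ R : ℝ[X], HasDerivAt (fun t : ℝ => aeval ((x : ℂ) + t * Complex.I) R)
      ((R.derivative.eval x : ℝ) * Complex.I) 0 := by
    intro R
    have h1 := R.hasDerivAt_aeval ((x : ℂ) + ((0 : ℝ) : ℂ) * Complex.I)
    have h2 := h1.comp (0 : ℝ) hline
    have h3 : aeval ((x : ℂ) + ((0 : ℝ) : ℂ) * Complex.I) R.derivative =
        ((R.derivative.eval x : ℝ) : ℂ) := by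
      simpa using aeval_algebraMap_apply ℂ x R.derivative
    rw [h3] at h2
    exact h2
  have hre : ∀ R : ℝ[X], HasDerivAt (fun t : ℝ => (aeval ((x : ℂ) + t * Complex.I) R).re) 0 0 := by
    intro R
    have h1 := Complex.reCLM.hasFDerivAt.comp_hasDerivAt (0 : ℝ) (hd R)
    have h2 : Complex.reCLM ((R.derivative.eval x : ℝ) * Complex.I) = 0 := by simp
    rw [h2] at h1
    exact h1
  have him : ∀ R : ℝ[X], HasDerivAt (fun t : ℝ => (aeval ((x : ℂ) + t * Complex.I) R).im)
      (R.derivative.eval x) 0 := by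
    intro R
    have h1 := Complex.imCLM.hasFDerivAt.comp_hasDerivAt (0 : ℝ) (hd R)
    have h2 : Complex.imCLM ((R.derivative.eval x : ℝ) * Complex.I) = R.derivative.eval x := by simp
    rw [h2] at h1
    exact h1
  have h0 : ∀ R : ℝ[X], aeval ((x : ℂ) + ((0 : ℝ) : ℂ) * Complex.I) R = ((R.eval x : ℝ) : ℂ) := by
    intro R
    simpa using aeval_algebraMap_apply ℂ x R
  have hφ := ((((him P).mul (hre Q)).sub ((hre P).mul (him Q))).sub
    ((hasDerivAt_id (0 : ℝ)).mul (((hre Q).mul (hre Q)).add ((him Q).mul (him Q)))))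
  have hlim := hφ.tendsto_slope_zero_right
  have := ge_of_tendsto hlim (b := 0) (by
    filter_upwards [self_mem_nhdsWithin] with t ht
    have ht : 0 < t := ht
    obtain ⟨hne, hle⟩ := h ((x : ℂ) + t * Complex.I) (by simpa using ht)
    have hn : 0 < Complex.normSq (aeval ((x : ℂ) + t * Complex.I) Q) := Complex.normSq_pos.2 hne
    rw [Complex.div_im, ← sub_div, le_div_iff₀ hn, Complex.normSq_apply] at hle
    simp only [Complex.add_im, Complex.ofReal_im, Complex.mul_im, Complex.ofReal_re,
      Complex.I_im, Complex.I_re, mul_one, mul_zero, zero_add, add_zero] at hle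
    simp only [zero_add, Pi.sub_apply, Pi.mul_apply, Pi.add_apply, id_eq, h0, Complex.ofReal_im,
      Complex.ofReal_re, smul_eq_mul]
    refine mul_nonneg (inv_nonneg.2 ht.le) ?_
    nlinarith)
  simp only [h0, Complex.ofReal_im, Complex.ofReal_re, id_eq, Pi.add_apply, Pi.mul_apply] at this
  nlinarith

/-- The Wronskian inequality says that `P / Q` has derivative at least `1` wherever `Q` does not
vanish. -/
theorem div_add_le_div (h : IsNevanlinnaPair P Q) {x y : ℝ} (hxy : x ≤ y)
    (hQ : ∀ t, x ≤ t → 0 < Q.eval t) :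
    P.eval x / Q.eval x + (y - x) ≤ P.eval y / Q.eval y := by
  have hder : ∀ t ∈ Set.Ici x, HasDerivAt (fun t => P.eval t / Q.eval t - t)
      ((P.derivative.eval t * Q.eval t - P.eval t * Q.derivative.eval t) / Q.eval t ^ 2 - 1) t :=
    fun t ht => ((P.hasDerivAt t).div (Q.hasDerivAt t) (hQ t ht).ne').sub (hasDerivAt_id t)
  have hmono : MonotoneOn (fun t => P.eval t / Q.eval t - t) (Set.Ici x) := by
    apply monotoneOn_of_deriv_nonneg (convex_Ici x)
    · exact fun t ht => (hder t ht).continuousAt.continuousWithinAt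
    · exact fun t ht => (hder t (interior_subset ht)).differentiableAt.differentiableWithinAt
    · intro t ht
      have ht := interior_subset ht
      rw [(hder t ht).deriv, sub_nonneg, le_div_iff₀ (pow_pos (hQ t ht) 2), one_mul]
      exact h.sq_le_wronskian t
  have := hmono Set.self_mem_Ici hxy hxy
  simp only at this
  linarith

theorem mul_le_mul_eval (h : IsNevanlinnaPair P Q) {x y : ℝ} (hxy : x ≤ y)
    (hQ : ∀ t, x ≤ t → 0 < Q.eval t) : P.eval x * Q.eval y ≤ P.eval y * Q.eval x := by
  have h1 := h.div_add_le_div hxy hQ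
  rw [← div_le_div_iff₀ (hQ x le_rfl) (hQ y hxy)]
  linarith

theorem eventually_pos (h : IsNevanlinnaPair P Q) (hQ : ∀ᶠ x in Filter.atTop, 0 < Q.eval x) :
    ∀ᶠ x in Filter.atTop, 0 < P.eval x := by
  obtain ⟨a, ha⟩ := Filter.eventually_atTop.1 hQ
  filter_upwards [Filter.eventually_gt_atTop (a + |P.eval a / Q.eval a|)] with y hy
  have hay : a ≤ y := by linarith [abs_nonneg (P.eval a / Q.eval a)]
  have h1 := h.div_add_le_div hay ha
  have h2 : 0 < P.eval y / Q.eval y := by linarith [neg_abs_le (P.eval a / Q.eval a)]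
  exact (div_pos_iff_of_pos_right (ha y hay)).1 h2

/-- All roots of `Q` are at most the largest root of `P`. -/
theorem pos_of_pos (h : IsNevanlinnaPair P Q) (hQ : ∀ᶠ x in Filter.atTop, 0 < Q.eval x) {B : ℝ}
    (hP : ∀ x, B < x → 0 < P.eval x) {x : ℝ} (hx : B < x) : 0 < Q.eval x := by
  by_contra! hneg
  obtain ⟨a, ha⟩ := Filter.eventually_atTop.1 hQ
  set S : Set ℝ := {t | x ≤ t ∧ Q.eval t ≤ 0} with hS
  have hSne : S.Nonempty := ⟨x, le_rfl, hneg⟩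
  have hSbdd : BddAbove S := ⟨a, fun t ht => by
    by_contra! hat
    exact absurd ht.2 (not_le.2 (ha t hat.le))⟩
  have hSclosed : IsClosed S :=
    isClosed_Ici.inter (isClosed_le Q.continuous continuous_const)
  have hmem := hSclosed.csSup_mem hSne hSbdd
  -- To the right of the last point `α` where `Q ≤ 0`, the ratio `P / Q` increases.
  -- Cross-multiplied, this survives the limit `t → α` and contradicts `Q(α) ≤ 0 < P(α)`.
  set α := sSup S
  have hpos : ∀ t, α < t → 0 < Q.eval t := by
    intro t ht
    by_contra! hle
    exact absurd (le_csSup hSbdd (show t ∈ S from ⟨hmem.1.trans ht.le, hle⟩)) (not_le.2 ht)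
  have hlim : ∀ R : ℝ[X], Filter.Tendsto (fun t => R.eval t) (nhdsWithin α (Set.Ioi α))
      (nhds (R.eval α)) := fun R => R.continuous.continuousAt.continuousWithinAt
  have hle : P.eval α * Q.eval (α + 1) ≤ P.eval (α + 1) * Q.eval α := by
    refine le_of_tendsto_of_tendsto ((hlim P).mul_const _) ((hlim Q).const_mul _) ?_
    filter_upwards [Ioo_mem_nhdsGT (show α < α + 1 by linarith)] with t ht
    exact h.mul_le_mul_eval ht.2.le fun r hr => hpos r (ht.1.trans_le hr)
  have h1 := hP α (hx.trans_le hmem.1)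
  have h2 := hP (α + 1) (by linarith [hmem.1])
  have h3 := hpos (α + 1) (by linarith)
  have h4 := hmem.2
  nlinarith [mul_pos h1 h3]

end IsNevanlinnaPair

/-- If `P₁` and `P₂` have the common interlacing polynomial `Q` and their sum has no root above `B`,
then one of them has no root above `B`. -/
theorem pos_or_pos_of_add_pos {P₁ P₂ P Q : ℝ[X]} (h₁ : IsNevanlinnaPair P₁ Q)
    (h₂ : IsNevanlinnaPair P₂ Q) (h : IsNevanlinnaPair P Q)
    (hQ : ∀ᶠ x in Filter.atTop, 0 < Q.eval x) {B : ℝ} (hP : ∀ x, B < x → 0 < P.eval x)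
    (hadd : P₁ + P₂ = 2 * P) :
    (∀ x, B < x → 0 < P₁.eval x) ∨ (∀ x, B < x → 0 < P₂.eval x) := by
  have hQpos : ∀ x, B < x → 0 < Q.eval x := fun x hx => h.pos_of_pos hQ hP hx
  -- As `R / Q` is increasing and `Q > 0` beyond `B`, nonpositivity of `R` spreads to the left. If
  -- both summands failed, they would be nonpositive together at the smaller of the two points,
  -- where their sum is positive.
  have hneg : ∀ {R : ℝ[X]}, IsNevanlinnaPair R Q → ∀ {x y : ℝ}, B < x → x ≤ y →
      R.eval y ≤ 0 → R.eval x ≤ 0 := by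
    intro R hR x y hx hxy hy
    have h1 := hR.mul_le_mul_eval hxy fun t ht => hQpos t (hx.trans_le ht)
    have h2 := hQpos x hx
    have h3 := hQpos y (hx.trans_le hxy)
    by_contra! h4
    nlinarith [mul_pos h4 h3]
  have hsum : ∀ x, P₁.eval x + P₂.eval x = 2 * P.eval x := by
    intro x
    have := congrArg (eval x) hadd
    simpa using this
  by_contra! hcon
  obtain ⟨⟨x, hx, hx1⟩, ⟨y, hy, hy1⟩⟩ := hcon
  rcases le_total x y with hxy | hxy
  · linarith [hneg h₂ hx hxy hy1, hsum x, hP x hx]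
  · linarith [hneg h₁ hy hxy hx1, hsum y, hP y hy]

end Interlacing
end

/-! ### Principal minors and the effect of one signed edge -/

noncomputable section

section PrincipalMinors

variable {W : Type*} [DecidableEq W] {R : Type*} [CommRing R]

open Matrix Function

/-- The matrix whose rows in `T` are those of `diagonal x - A`, and whose other rows are those of
the identity matrix. -/
def rowRestrict (A : Matrix W W R) (x : W → R) (T : Finset W) : Matrix W W R :=
  of fun v => if v ∈ T then (diagonal x - A) v else (1 : Matrix W W R) v

theorem rowRestrict_erase (A : Matrix W W R) (x : W → R) (T : Finset W) (u : W) :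
    rowRestrict A x (T.erase u) = updateRow (rowRestrict A x T) u (Pi.single u 1) := by
  ext v w
  by_cases hv : v = u
  · subst hv
    simp [rowRestrict, one_apply, Pi.single_apply, eq_comm]
  · simp [rowRestrict, hv]

/-- The adjacency matrix of a single edge. -/
def edgeMatrix (R : Type*) [CommRing R] (e : W × W) : Matrix W W R :=
  single e.1 e.2 1 + single e.2 e.1 1

theorem edgeMatrix_isSymm (e : W × W) : (edgeMatrix R e).IsSymm := by
  rw [IsSymm, edgeMatrix, transpose_add, transpose_single, transpose_single, add_comm]

theorem edgeMatrix_map {S : Type*} [CommRing S] (φ : R →+* S) (e : W × W) :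
    (edgeMatrix R e).map φ = edgeMatrix S e := by
  ext v w
  simp [edgeMatrix, single_apply, apply_ite φ]

variable [Fintype W]

/-- The principal minor of `diagonal x - A` on `T`. -/
def principalMinor (A : Matrix W W R) (x : W → R) (T : Finset W) : R :=
  (rowRestrict A x T).det

theorem principalMinor_map {S : Type*} [CommRing S] (φ : R →+* S) (A : Matrix W W R) (x : W → R)
    (T : Finset W) : φ (principalMinor A x T) = principalMinor (A.map φ) (φ ∘ x) T := by
  rw [principalMinor, RingHom.map_det, principalMinor]
  congr 1
  ext v w
  by_cases hv : v ∈ T <;> simp [rowRestrict, hv, diagonal_apply, one_apply, apply_ite φ]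

theorem principalMinor_univ (A : Matrix W W R) (x : W → R) :
    principalMinor A x Finset.univ = (diagonal x - A).det := by
  rw [principalMinor]
  congr 1
  ext v w
  simp [rowRestrict]

theorem principalMinor_zero (x : W → R) (T : Finset W) :
    principalMinor 0 x T = ∏ v ∈ T, x v := by
  have h : rowRestrict 0 x T = diagonal fun v => if v ∈ T then x v else 1 := by
    ext v w
    by_cases hv : v ∈ T <;> simp [rowRestrict, hv, diagonal_apply, one_apply]
  rw [principalMinor, h, det_diagonal, Finset.prod_ite_mem, Finset.univ_inter]

theorem principalMinor_update_of_notMem (A : Matrix W W R) (x : W → R) {T : Finset W} {u : W}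
    (hu : u ∉ T) (z : R) : principalMinor A (update x u z) T = principalMinor A x T := by
  rw [principalMinor, principalMinor]
  congr 1
  ext v w
  by_cases hv : v ∈ T
  · have : v ≠ u := by rintro rfl; exact hu hv
    simp [rowRestrict, hv, diagonal_apply, this]
  · simp [rowRestrict, hv]

theorem principalMinor_update_of_mem (A : Matrix W W R) (x : W → R) {T : Finset W} {u : W}
    (hu : u ∈ T) (z : R) : principalMinor A (update x u z) T =
      principalMinor A x T + (z - x u) * principalMinor A x (T.erase u) := by
  have h : rowRestrict A (update x u z) T = updateRow (rowRestrict A x T) u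
      (rowRestrict A x T u + (z - x u) • Pi.single u 1) := by
    ext v w
    by_cases hv : v = u
    · subst hv
      by_cases hw : v = w
      · subst hw; simp [rowRestrict, hu]
      · simp [rowRestrict, hu, hw, Ne.symm hw]
    · by_cases hvT : v ∈ T <;> simp [rowRestrict, hv, hvT, diagonal_apply]
  rw [principalMinor, h, det_updateRow_add, det_updateRow_smul, updateRow_eq_self,
    principalMinor, principalMinor, rowRestrict_erase]

/-- A kernel vector `y` is supported on `T` and satisfies `∑ x v |y v|² = y* A y`, which is real
because `A` is symmetric. Taking imaginary parts forces `y = 0`. -/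
theorem principalMinor_ne_zero {A : Matrix W W ℝ} (hA : A.IsSymm) (x : W → ℂ)
    (hx : ∀ v, 0 < (x v).im) (T : Finset W) :
    principalMinor (A.map (algebraMap ℝ ℂ)) x T ≠ 0 := by
  intro h
  obtain ⟨y, hy0, hy⟩ := exists_mulVec_eq_zero_iff.2 h
  have hout : ∀ v ∉ T, y v = 0 := by
    intro v hv
    have := congrFun hy v
    simpa [rowRestrict, mulVec, dotProduct, hv, one_apply] using this
  have hin : ∀ v ∈ T, x v * y v = ∑ w, (A v w : ℂ) * y w := by
    intro v hv
    have := congrFun hy v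
    simpa [rowRestrict, mulVec, dotProduct, hv, diagonal_apply, sub_mul, Finset.sum_sub_distrib,
      sub_eq_zero] using this
  have hsum : ∑ v, star (y v) * (x v * y v) = ∑ v, ∑ w, star (y v) * ((A v w : ℂ) * y w) := by
    refine Finset.sum_congr rfl fun v _ => ?_
    by_cases hv : v ∈ T
    · rw [hin v hv, Finset.mul_sum]
    · simp [hout v hv]
  have hreal : star (∑ v, ∑ w, star (y v) * ((A v w : ℂ) * y w)) =
      ∑ v, ∑ w, star (y v) * ((A v w : ℂ) * y w) := by
    rw [star_sum, Finset.sum_comm]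
    simp only [star_sum]
    rw [Finset.sum_comm, Finset.sum_comm]
    refine Finset.sum_congr rfl fun v _ => Finset.sum_congr rfl fun w _ => ?_
    have : A w v = A v w := hA.apply v w
    simp [this]
    ring
  have him : (∑ v, star (y v) * (x v * y v)).im = 0 := by
    rw [hsum]
    exact Complex.conj_eq_iff_im.1 hreal
  have him2 : (∑ v, star (y v) * (x v * y v)).im = ∑ v, (x v).im * Complex.normSq (y v) := by
    rw [Complex.im_sum]
    refine Finset.sum_congr rfl fun v _ => ?_
    simp [Complex.normSq_apply]
    ring
  rw [him2, Finset.sum_eq_zero_iff_of_nonneg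
    (fun v _ => mul_nonneg (hx v).le (Complex.normSq_nonneg _))] at him
  apply hy0
  funext v
  have := him v (Finset.mem_univ v)
  rcases mul_eq_zero.1 this with h | h
  · exact absurd h (hx v).ne'
  · exact Complex.normSq_eq_zero.1 h

theorem isStableFamily_principalMinor {A : Matrix W W ℝ} (hA : A.IsSymm) :
    IsStableFamily fun T x => principalMinor (A.map (algebraMap ℝ ℂ)) x T where
  affine _ _ hu x z := principalMinor_update_of_mem _ x hu z
  indep _ _ hu x z := principalMinor_update_of_notMem _ x hu z
  ne_zero T x hx := principalMinor_ne_zero hA x hx T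

/-- Multilinearity of the determinant in the two rows of `e`. The terms linear in `c` cancel in the
average over `c = ±1`; the quadratic one is a minor with two rows swapped, hence the minus sign. -/
theorem principalMinor_sub_smul_edgeMatrix (A : Matrix W W R) (x : W → R) (e : W × W)
    (he : e.1 ≠ e.2) (c : R) (T : Finset W) : principalMinor (A - c • edgeMatrix R e) x T =
    principalMinor A x T +
      (if e.1 ∈ T then c * (updateRow (rowRestrict A x T) e.1 (Pi.single e.2 1)).det else 0) +
      (if e.2 ∈ T then c * (updateRow (rowRestrict A x T) e.2 (Pi.single e.1 1)).det else 0) -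
      (if e.1 ∈ T ∧ e.2 ∈ T then c ^ 2 * principalMinor A x ((T.erase e.1).erase e.2) else 0) := by
  obtain ⟨u, v⟩ := e
  simp only at he ⊢
  set N := rowRestrict A x T with hN
  have h : rowRestrict (A - c • edgeMatrix R (u, v)) x T =
      updateRow (updateRow N u (N u + (if u ∈ T then c else 0) • Pi.single v 1)) v
        (N v + (if v ∈ T then c else 0) • Pi.single u 1) := by
    ext i j
    by_cases hi : i = v
    · subst hi
      by_cases hvT : i ∈ T
      · simp [hN, rowRestrict, hvT, edgeMatrix, single_apply, he, Pi.single_apply, eq_comm]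
        ring
      · simp [hN, rowRestrict, hvT]
    · by_cases hi' : i = u
      · subst hi'
        by_cases huT : i ∈ T
        · simp [hN, rowRestrict, huT, hi, edgeMatrix, single_apply, he.symm, Pi.single_apply,
            eq_comm]
          ring
        · simp [hN, rowRestrict, huT, hi]
      · by_cases hiT : i ∈ T
        · simp [hN, rowRestrict, hiT, hi, hi', Ne.symm hi, Ne.symm hi', edgeMatrix]
        · simp [hN, rowRestrict, hiT, hi, hi']
  have hdouble : u ∈ T → v ∈ T → (updateRow (updateRow N u (Pi.single v 1)) v (Pi.single u 1)).det =
      - principalMinor A x ((T.erase u).erase v) := by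
    intro hu hv
    rw [principalMinor, rowRestrict_erase, rowRestrict_erase, ← hN]
    have hswap : updateRow (updateRow N u (Pi.single v 1)) v (Pi.single u 1) =
        (updateRow (updateRow N u (Pi.single u 1)) v (Pi.single v 1)).submatrix
          (Equiv.swap u v) id := by
      ext i j
      by_cases hi : i = v
      · subst hi; simp [he]
      · by_cases hi' : i = u
        · subst hi'; simp [hi]
        · rw [submatrix_apply, Equiv.swap_apply_of_ne_of_ne hi' hi]
          simp [hi, hi']
    rw [hswap, det_permute, Equiv.Perm.sign_swap he]
    simp
  rw [principalMinor, h, det_updateRow_add, det_updateRow_smul]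
  have h1 : updateRow (updateRow N u (N u + (if u ∈ T then c else 0) • Pi.single v 1)) v (N v) =
      updateRow N u (N u + (if u ∈ T then c else 0) • Pi.single v 1) := by
    rw [updateRow_comm _ he, updateRow_eq_self]
  rw [h1, updateRow_comm _ he, det_updateRow_add, det_updateRow_smul, det_updateRow_add,
    det_updateRow_smul, updateRow_eq_self, updateRow_comm N he.symm,
    updateRow_comm N he.symm]
  have h2 : updateRow (updateRow N u (N u)) v (Pi.single u 1) =
      updateRow N v (Pi.single u 1) := by rw [updateRow_eq_self]
  rw [h2]
  by_cases hu : u ∈ T <;> by_cases hv : v ∈ T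
  · rw [hdouble hu hv]
    simp [hu, hv, principalMinor, hN]
    ring
  all_goals simp [hu, hv, principalMinor, hN]

/-- Row `e.1` is a row of the identity here, so the remaining linear term is the determinant of a
matrix with two equal rows. -/
theorem principalMinor_sub_smul_edgeMatrix_of_notMem (A : Matrix W W R) (x : W → R) (e : W × W)
    (he : e.1 ≠ e.2) (c : R) {T : Finset W} (hT : e.1 ∉ T) :
    principalMinor (A - c • edgeMatrix R e) x T = principalMinor A x T := by
  have h : (updateRow (rowRestrict A x T) e.2 (Pi.single e.1 1)).det = 0 := by
    apply det_zero_of_row_eq he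
    ext w
    simp [he, rowRestrict, hT, one_apply, Pi.single_apply, eq_comm]
  rw [principalMinor_sub_smul_edgeMatrix A x e he, h]
  simp [hT]

theorem principalMinor_add_edgeMatrix_add_sub (A : Matrix W W R) (x : W → R) (e : W × W)
    (he : e.1 ≠ e.2) : principalMinor (A + edgeMatrix R e) x + principalMinor (A - edgeMatrix R e) x =
    edgeOp e (principalMinor A x) + edgeOp e (principalMinor A x) := by
  funext T
  have h1 := principalMinor_sub_smul_edgeMatrix A x e he 1 T
  have h2 := principalMinor_sub_smul_edgeMatrix A x e he (-1) T
  rw [neg_one_smul, sub_neg_eq_add] at h2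
  rw [one_smul] at h1
  rw [Pi.add_apply, Pi.add_apply, h1, h2, edgeOp]
  split_ifs <;> ring

end PrincipalMinors
end

/-! ### Choosing the signs one edge at a time -/

noncomputable section

section Signing

open Matrix Polynomial

variable {W : Type*} [DecidableEq W] [Fintype W]

/-- The characteristic polynomial of the principal submatrix of `A` on `T`. -/
def minorPoly (A : Matrix W W ℝ) (T : Finset W) : ℝ[X] :=
  principalMinor (A.map C) (fun _ => X) T

theorem eval_edgeOps_minorPoly (A : Matrix W W ℝ) (l : List (W × W)) (T : Finset W) (x : ℝ) :
    (edgeOps l (minorPoly A) T).eval x = edgeOps l (principalMinor A fun _ => x) T := by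
  have h1 : (principalMinor A fun _ => x) = fun T => evalRingHom x (minorPoly A T) := by
    funext T
    rw [minorPoly, principalMinor_map]
    congr 1
    · ext; simp
    · funext; simp
  rw [h1]
  exact (congrFun (edgeOps_map (evalRingHom x).toAddMonoidHom l (minorPoly A)) T).symm

theorem aeval_edgeOps_minorPoly (A : Matrix W W ℝ) (l : List (W × W)) (T : Finset W) (z : ℂ) :
    aeval z (edgeOps l (minorPoly A) T) =
      edgeOps l (fun T x => principalMinor (A.map (algebraMap ℝ ℂ)) x T) T fun _ => z := by
  have h1 : (fun T => principalMinor (A.map (algebraMap ℝ ℂ)) (fun _ => z) T) =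
      fun T => (aeval z : ℝ[X] →ₐ[ℝ] ℂ).toRingHom (minorPoly A T) := by
    funext T
    rw [minorPoly, principalMinor_map]
    congr 1
    · ext; simp
    · funext; simp
  have h2 := congrFun (edgeOps_map (aeval z : ℝ[X] →ₐ[ℝ] ℂ).toRingHom.toAddMonoidHom l
    (minorPoly A)) T
  have h3 := congrFun (edgeOps_map (Pi.evalAddMonoidHom (fun _ : W → ℂ => ℂ) fun _ => z) l
    (fun T x => principalMinor (A.map (algebraMap ℝ ℂ)) x T)) T
  exact h2.symm.trans ((congrFun (congrArg (edgeOps l) h1.symm) T).trans h3)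

theorem isNevanlinnaPair_edgeOps_minorPoly {A : Matrix W W ℝ} (hA : A.IsSymm) {l : List (W × W)}
    (hl : ∀ e ∈ l, e.1 ≠ e.2) {T : Finset W} {u : W} (hu : u ∈ T) :
    IsNevanlinnaPair (edgeOps l (minorPoly A) T) (edgeOps l (minorPoly A) (T.erase u)) := by
  intro z hz
  rw [aeval_edgeOps_minorPoly, aeval_edgeOps_minorPoly]
  have h := (isStableFamily_principalMinor hA).edgeOps hl
  exact ⟨h.ne_zero _ _ fun _ => hz, h.im_le_im_div hu fun _ => hz⟩

/-- Adding vertices one by one, each Nevanlinna pair passes positivity near infinity from the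
smaller set to the larger. -/
theorem eventually_pos_edgeOps_minorPoly {A : Matrix W W ℝ} (hA : A.IsSymm) {l : List (W × W)}
    (hl : ∀ e ∈ l, e.1 ≠ e.2) (T : Finset W) :
    ∀ᶠ x in Filter.atTop, 0 < (edgeOps l (minorPoly A) T).eval x := by
  induction T using Finset.induction_on with
  | empty =>
    rw [edgeOps_empty, minorPoly]
    have : principalMinor (A.map C) (fun _ => X) ∅ = 1 := by
      rw [principalMinor, ← det_one (n := W)]
      congr 1
    simp [this]
  | insert u T hu ih =>
    have h := isNevanlinnaPair_edgeOps_minorPoly hA hl (Finset.mem_insert_self u T)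
    rw [Finset.erase_insert hu] at h
    exact h.eventually_pos ih

theorem minorPoly_add_edgeMatrix_add_sub (A : Matrix W W ℝ) (e : W × W) (he : e.1 ≠ e.2) :
    minorPoly (A + edgeMatrix ℝ e) + minorPoly (A - edgeMatrix ℝ e) =
      edgeOp e (minorPoly A) + edgeOp e (minorPoly A) := by
  have h := principalMinor_add_edgeMatrix_add_sub (A.map (C : ℝ →+* ℝ[X])) (fun _ => X) e he
  have h1 : (A + edgeMatrix ℝ e).map (C : ℝ →+* ℝ[X]) =
      A.map (C : ℝ →+* ℝ[X]) + edgeMatrix ℝ[X] e := by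
    rw [← edgeMatrix_map C e]
    ext; simp
  have h2 : (A - edgeMatrix ℝ e).map (C : ℝ →+* ℝ[X]) =
      A.map (C : ℝ →+* ℝ[X]) - edgeMatrix ℝ[X] e := by
    rw [← edgeMatrix_map C e]
    ext; simp
  rw [← h1, ← h2] at h
  exact h

/-- The signs of the edges can be chosen one after the other without moving the largest root of
the averaged characteristic polynomial to the right. -/
theorem exists_signs_of_edgeOps_pos (l : List (W × W)) (hl : ∀ e ∈ l, e.1 ≠ e.2) (hnd : l.Nodup)
    (A : Matrix W W ℝ) (hA : A.IsSymm) (B : ℝ)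
    (hB : ∀ x, B < x → 0 < (edgeOps l (minorPoly A) Finset.univ).eval x) :
    ∃ σ : W × W → ℝ, (∀ e, σ e = 1 ∨ σ e = -1) ∧ ∀ x, B < x →
      0 < (minorPoly (A + (l.map fun e => σ e • edgeMatrix ℝ e).sum) Finset.univ).eval x := by
  induction l generalizing A with
  | nil => exact ⟨fun _ => 1, fun _ => Or.inl rfl, by simpa using hB⟩
  | cons e l ih =>
    have he : e.1 ≠ e.2 := hl e (by simp)
    have hl' : ∀ e ∈ l, e.1 ≠ e.2 := fun e' he' => hl e' (by simp [he'])
    rw [List.nodup_cons] at hnd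
    obtain ⟨hel, hnd⟩ := hnd
    have hstep : ∃ c : ℝ, (c = 1 ∨ c = -1) ∧ ∀ x, B < x →
        0 < (edgeOps l (minorPoly (A + c • edgeMatrix ℝ e)) Finset.univ).eval x := by
      have hu : e.1 ∈ Finset.univ := Finset.mem_univ e.1
      -- With the endpoint `e.1` deleted, the sign `c` is invisible: this is the common interlacer
      -- of both choices and of their average.
      have hsame : ∀ c : ℝ, edgeOps l (minorPoly (A + c • edgeMatrix ℝ e))
          (Finset.univ.erase e.1) = edgeOps (e :: l) (minorPoly A) (Finset.univ.erase e.1) := by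
        intro c
        rw [edgeOps_cons]
        refine edgeOps_congr l fun S hS => ?_
        have heS : e.1 ∉ S := fun h => absurd (hS h) (by simp)
        rw [edgeOp, if_neg (fun h => heS h.1), minorPoly, minorPoly]
        convert principalMinor_sub_smul_edgeMatrix_of_notMem (A.map C) (fun _ => X) e he (C (-c)) heS
          using 2
        rw [← edgeMatrix_map C e]
        ext; simp
      have hsymm : ∀ c : ℝ, (A + c • edgeMatrix ℝ e).IsSymm :=
        fun c => hA.add ((edgeMatrix_isSymm e).smul c)
      have h1 := isNevanlinnaPair_edgeOps_minorPoly (hsymm 1) hl' hu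
      have h2 := isNevanlinnaPair_edgeOps_minorPoly (hsymm (-1)) hl' hu
      have h3 := isNevanlinnaPair_edgeOps_minorPoly hA hl hu
      rw [hsame] at h1 h2
      have hadd : edgeOps l (minorPoly (A + (1 : ℝ) • edgeMatrix ℝ e)) Finset.univ +
          edgeOps l (minorPoly (A + (-1 : ℝ) • edgeMatrix ℝ e)) Finset.univ =
          2 * edgeOps (e :: l) (minorPoly A) Finset.univ := by
        have h4 := minorPoly_add_edgeMatrix_add_sub A e he
        have h5 := congrFun (congrArg (edgeOps l) h4) Finset.univ
        rw [edgeOps_add, edgeOps_add, Pi.add_apply, Pi.add_apply, ← two_mul] at h5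
        rw [one_smul, neg_one_smul, ← sub_eq_add_neg]
        exact h5
      rcases pos_or_pos_of_add_pos h1 h2 h3 (eventually_pos_edgeOps_minorPoly hA hl _) hB hadd
        with h | h
      · exact ⟨1, Or.inl rfl, h⟩
      · exact ⟨-1, Or.inr rfl, h⟩
    obtain ⟨c, hc, hcB⟩ := hstep
    obtain ⟨σ, hσ, hσB⟩ := ih hl' hnd (A + c • edgeMatrix ℝ e)
      (hA.add ((edgeMatrix_isSymm e).smul c)) hcB
    refine ⟨Function.update σ e c, ?_, ?_⟩
    · intro e'
      by_cases h : e' = e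
      · subst h; simpa using hc
      · simpa [h] using hσ e'
    · have : (l.map fun e' => Function.update σ e c e' • edgeMatrix ℝ e') =
          l.map fun e' => σ e' • edgeMatrix ℝ e' := by
        apply List.map_congr_left
        intro e' he'
        rw [Function.update_of_ne (by rintro rfl; exact hel he')]
      rw [List.map_cons, List.sum_cons, this, Function.update_self, ← add_assoc]
      exact hσB

/-- Every graph has a signing whose adjacency matrix has no eigenvalue above the Heilmann-Lieb
bound of its matching polynomial. -/
theorem exists_signs (s : Finset (W × W)) (hs : ∀ e ∈ s, e.1 ≠ e.2) (a : W → ℝ)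
    (ha : ∀ u, 0 < a u) (B : ℝ) (hB : 0 ≤ B) (haB : ∀ e ∈ s, a e.1 + a e.2 ≤ B)
    (haa : ∀ e ∈ s, 1 ≤ a e.1 * a e.2)
    (hdeg : ∀ u, ((s.filter fun e => e.1 = u ∨ e.2 = u).card : ℝ) ≤ a u ^ 2 + 1) :
    ∃ σ : W × W → ℝ, (∀ e, σ e = 1 ∨ σ e = -1) ∧ ∀ (x : ℝ) (y : W → ℝ), B < x →
      (∑ e ∈ s, σ e • edgeMatrix ℝ e) *ᵥ y = x • y → y = 0 := by
  have hzero : ∀ x : ℝ, principalMinor (0 : Matrix W W ℝ) (fun _ => x) = fun T => ∏ _v ∈ T, x :=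
    fun x => funext fun T => principalMinor_zero _ T
  -- Starting from the zero matrix, whose minor on `T` is `x ^ |T|`, the fully averaged polynomial
  -- is the matching polynomial.
  obtain ⟨σ, hσ, hpos⟩ := exists_signs_of_edgeOps_pos s.toList (by simpa using hs) s.nodup_toList 0
    (isSymm_zero) B (fun x hx => by
      rw [eval_edgeOps_minorPoly, hzero]
      exact edgeOps_matching_pos s hs a ha x (hB.trans_lt hx)
        (fun e he => (haB e he).trans_lt hx) haa hdeg _)
  refine ⟨σ, hσ, fun x y hx hy => ?_⟩
  have h := hpos x hx
  rw [zero_add, Finset.sum_map_toList] at h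
  have h1 := eval_edgeOps_minorPoly (∑ e ∈ s, σ e • edgeMatrix ℝ e) [] Finset.univ x
  rw [edgeOps_nil, edgeOps_nil, principalMinor_univ] at h1
  rw [h1] at h
  by_contra hy0
  refine h.ne' (exists_mulVec_eq_zero_iff.1 ⟨y, hy0, ?_⟩)
  rw [sub_mulVec, hy]
  ext v
  simp

end Signing
end

/-! ### Bipartite graphs and singular values -/

noncomputable section

section BipartiteSigning

open Matrix

/-- Every bipartite graph with degrees at most `d` on one side and at most `r` on the other has a
signing such that all singular values of its biadjacency matrix are at most
`√(d - 1) + √(r - 1)`. -/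
theorem exists_bipartite_signs {V E : Type*} [Fintype V] [DecidableEq V] [Fintype E]
    [DecidableEq E] (I : Finset (V × E)) (d r : ℕ) (hd : 2 ≤ d) (hr : 2 ≤ r)
    (hV : ∀ v, (I.filter fun p => p.1 = v).card ≤ d)
    (hE : ∀ e, (I.filter fun p => p.2 = e).card ≤ r) :
    ∃ σ : V → E → ℝ, (∀ v e, σ v e = 1 ∨ σ v e = -1) ∧
      ∀ N : Matrix V E ℝ, (∀ v e, N v e = if (v, e) ∈ I then σ v e else 0) →
      ∀ (μ : ℝ) (f : V → ℝ), f ≠ 0 → N *ᵥ (Nᵀ *ᵥ f) = μ • f →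
        μ ≤ (√((d : ℝ) - 1) + √((r : ℝ) - 1)) ^ 2 := by
  have hd1 : (1 : ℝ) ≤ (d : ℝ) - 1 := by
    have : (2 : ℝ) ≤ d := by exact_mod_cast hd
    linarith
  have hr1 : (1 : ℝ) ≤ (r : ℝ) - 1 := by
    have : (2 : ℝ) ≤ r := by exact_mod_cast hr
    linarith
  set p := √((d : ℝ) - 1) with hp
  set q := √((r : ℝ) - 1) with hq
  have hp1 : 1 ≤ p := Real.one_le_sqrt.2 hd1
  have hq1 : 1 ≤ q := Real.one_le_sqrt.2 hr1
  have hp2 : p ^ 2 + 1 = d := by rw [hp, Real.sq_sqrt (by linarith)]; ring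
  have hq2 : q ^ 2 + 1 = r := by rw [hq, Real.sq_sqrt (by linarith)]; ring
  let ι : V × E ↪ (V ⊕ E) × (V ⊕ E) :=
    ⟨fun x => (Sum.inl x.1, Sum.inr x.2), fun x y h => by
      simp only [Prod.mk.injEq, Sum.inl.injEq, Sum.inr.injEq] at h
      exact Prod.ext h.1 h.2⟩
  have hι : ∀ x, ι x = (Sum.inl x.1, Sum.inr x.2) := fun _ => rfl
  obtain ⟨σ, hσ, hmain⟩ := exists_signs (I.map ι)
    (by
      intro e he
      obtain ⟨x, _, rfl⟩ := Finset.mem_map.1 he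
      simp [hι])
    (Sum.elim (fun _ => p) fun _ => q) (by rintro (v | e) <;> simp <;> linarith) (p + q)
    (by linarith)
    (by
      intro e he
      obtain ⟨x, _, rfl⟩ := Finset.mem_map.1 he
      simp [hι])
    (by
      intro e he
      obtain ⟨x, _, rfl⟩ := Finset.mem_map.1 he
      simp only [hι, Sum.elim_inl, Sum.elim_inr]
      nlinarith)
    (by
      intro u
      rw [Finset.filter_map, Finset.card_map]
      rcases u with v | e
      · simp only [Function.comp_def, hι, Sum.inl.injEq, reduceCtorEq, or_false, Sum.elim_inl, hp2]
        exact_mod_cast hV v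
      · simp only [Function.comp_def, hι, Sum.inr.injEq, reduceCtorEq, false_or, Sum.elim_inr, hq2]
        exact_mod_cast hE e)
  refine ⟨fun v e => σ (Sum.inl v, Sum.inr e), fun v e => hσ _, ?_⟩
  intro N hN μ f hf hμ
  have hA : ∑ e ∈ I.map ι, σ e • edgeMatrix ℝ e = fromBlocks 0 N Nᵀ 0 := by
    rw [Finset.sum_map]
    have hpair : ∀ (x : V × E) (v : V) (e : E), (x.1 = v ∧ x.2 = e) ↔ x = (v, e) := by
      rintro ⟨a, b⟩ v e
      simp
    have hpair' : ∀ (x : V × E) (v : V) (e : E), (x.2 = e ∧ x.1 = v) ↔ x = (v, e) :=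
      fun x v e => and_comm.trans (hpair x v e)
    ext i j
    rcases i with v | e <;> rcases j with w | e' <;>
      simp [Matrix.sum_apply, edgeMatrix, hι, single_apply, hN, hpair, hpair']
  by_contra! hlt
  have hμ0 : 0 ≤ μ := le_trans (sq_nonneg _) hlt.le
  have hθ : p + q < √μ := by
    rw [← Real.sqrt_sq (show 0 ≤ p + q by linarith)]
    exact Real.sqrt_lt_sqrt (sq_nonneg _) hlt
  -- An eigenvector `f` of `N * Nᵀ` for `μ` yields the eigenvector `(√μ f, Nᵀ f)` of the bipartite
  -- adjacency matrix for `√μ`.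
  have hy := hmain √μ (Sum.elim (√μ • f) (Nᵀ *ᵥ f)) hθ (by
    rw [hA, fromBlocks_mulVec]
    ext i
    rcases i with v | e
    · simp [hμ, ← mul_assoc, Real.mul_self_sqrt hμ0]
    · simp [mulVec_smul])
  apply hf
  funext v
  have := congrFun hy (Sum.inl v)
  have hne : √μ ≠ 0 := by
    have : 0 < √μ := by linarith
    exact this.ne'
  simpa [hne] using this

end BipartiteSigning

/-! ### Characteristic polynomials of two-sheeted block matrices -/

section BlockCharpoly

open Matrix

theorem det_fromBlocks_swap {n R : Type*} [Fintype n] [DecidableEq n] [CommRing R]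
    (A B : Matrix n n R) : (fromBlocks A B B A).det = (A + B).det * (A - B).det := by
  have h : fromBlocks 1 1 0 1 * fromBlocks A B B A * fromBlocks 1 (-1) 0 1 =
      fromBlocks (A + B) 0 B (A - B) := by
    simp only [fromBlocks_multiply]
    congr 1 <;> simp <;> abel
  have h1 := congrArg det h
  rw [det_mul, det_mul, det_fromBlocks_zero₂₁, det_fromBlocks_zero₂₁,
    det_fromBlocks_zero₁₂] at h1
  simpa using h1

theorem charpoly_fromBlocks_swap {n R : Type*} [Fintype n] [DecidableEq n] [CommRing R]
    (P Q : Matrix n n R) :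
    (fromBlocks P Q Q P).charpoly = (P + Q).charpoly * (P - Q).charpoly := by
  rw [charpoly, charmatrix_fromBlocks, det_fromBlocks_swap, charpoly, charpoly]
  congr 2
  · ext; simp [charmatrix]; ring
  · ext; simp [charmatrix]; ring

theorem exists_eigenvector_of_mem_roots_charpoly {n K : Type*} [Fintype n] [DecidableEq n]
    [Field K] {M : Matrix n n K} {μ : K} (h : μ ∈ M.charpoly.roots) :
    ∃ f : n → K, f ≠ 0 ∧ M *ᵥ f = μ • f := by
  have h1 := (Polynomial.mem_roots'.1 h).2
  rw [Polynomial.IsRoot, eval_charpoly] at h1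
  obtain ⟨f, hf, hf0⟩ := exists_mulVec_eq_zero_iff.2 h1
  refine ⟨f, hf, ?_⟩
  rw [sub_mulVec, sub_eq_zero] at hf0
  rw [← hf0]
  ext i
  simp [scalar_apply, mulVec_diagonal]

end BlockCharpoly
end

/-! ### Two-lifts and their spectra -/

noncomputable section

namespace FinHypergraph

open Matrix

/-- One of the two lifts of the edge `e` under the signing `s`. -/
def liftEdge {V : Type} (s : V → Set V → Bool) (e : Set V) (b : Bool) : Set (V × Bool) :=
  {p | p.1 ∈ e ∧ (s p.1 e ^^ p.2) = b}

/-- The `2`-lift of a hypergraph given by signs of its incidences. -/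
def lift (H : FinHypergraph) (s : H.V → Set H.V → Bool) : FinHypergraph :=
  ofEdges (H.V × Bool) {L | ∃ e ∈ H.edges, ∃ b, L = liftEdge s e b}

section Lift

variable {V : Type} (s : V → Set V → Bool)

theorem image_fst_liftEdge (e : Set V) (b : Bool) : Prod.fst '' liftEdge s e b = e := by
  ext v
  constructor
  · rintro ⟨p, hp, rfl⟩
    exact hp.1
  · intro hv
    exact ⟨(v, s v e ^^ b), ⟨hv, by simp⟩, rfl⟩

theorem injOn_fst_liftEdge (e : Set V) (b : Bool) : Set.InjOn Prod.fst (liftEdge s e b) := by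
  rintro ⟨v, i⟩ ⟨_, hi⟩ ⟨w, j⟩ ⟨_, hj⟩ h
  simp only at h hi hj
  subst h
  rw [← hj, Bool.xor_right_inj] at hi
  rw [hi]

variable {s}

theorem liftEdge_injective {e e' : Set V} {b b' : Bool} (he : e.Nonempty)
    (h : liftEdge s e b = liftEdge s e' b') : e = e' ∧ b = b' := by
  have h1 : e = e' := by rw [← image_fst_liftEdge s e b, h, image_fst_liftEdge]
  subst h1
  obtain ⟨v, hv⟩ := he
  have h2 : (v, s v e ^^ b) ∈ liftEdge s e b := ⟨hv, by simp⟩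
  rw [h] at h2
  exact ⟨rfl, by simpa using h2.2⟩

end Lift

theorem IsRegular.nonempty_of_mem_edges {H : FinHypergraph} {d r : ℕ} (h : H.IsRegular d r)
    {e : Set H.V} (he : e ∈ H.edges) : e.Nonempty := by
  apply Set.nonempty_of_ncard_ne_zero
  have := h.1
  have := h.2.2 e he
  omega

variable (H : FinHypergraph) (s : H.V → Set H.V → Bool)

/-- The projection of a `2`-lift. -/
def liftFst : (H.lift s).V → H.V := Prod.fst

theorem image_liftFst (e : Set H.V) (b : Bool) : liftFst H s '' liftEdge s e b = e :=
  image_fst_liftEdge s e b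

theorem isCoveringProjection_lift : IsCoveringProjection (H.lift s) H (liftFst H s) where
  surjective v := ⟨(v, true), rfl⟩
  map_edge := by
    rintro _ ⟨e, he, b, rfl⟩
    rw [image_liftFst]
    exact he
  injOn_edge := by
    rintro _ ⟨e, he, b, rfl⟩
    exact injOn_fst_liftEdge s e b
  bijOn_edgesAt := by
    rintro ⟨v, i⟩
    refine ⟨?_, ?_, ?_⟩
    · rintro _ ⟨⟨e, he, b, rfl⟩, hv⟩
      have h : e ∈ H.edgesAt v := ⟨he, hv.1⟩
      rwa [← image_liftFst H s e b] at h
    · rintro _ ⟨⟨e, he, b, rfl⟩, hv⟩ _ ⟨⟨e', he', b', rfl⟩, hv'⟩ h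
      have h1 : e = e' := (image_liftFst H s e b).symm.trans (h.trans (image_liftFst H s e' b'))
      subst h1
      rw [← hv.2, ← hv'.2]
    · rintro e ⟨he, hv⟩
      exact ⟨liftEdge s e (s v e ^^ i), ⟨⟨e, he, _, rfl⟩, hv, rfl⟩, image_liftFst H s e _⟩

variable {H} {d r : ℕ}

theorem IsRegular.isCover_lift (hH : H.IsRegular d r) : IsCover 2 (H.lift s) H := by
  refine ⟨liftFst H s, isCoveringProjection_lift H s, ?_, ?_⟩
  · intro v
    have : ({w | w.1 = v} : Set (H.V × Bool)) = {(v, true), (v, false)} := by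
      ext ⟨w, i⟩
      cases i <;> simp
    exact (congrArg Set.ncard this).trans (Set.ncard_pair (by simp))
  · intro e he
    have : {f ∈ (H.lift s).edges | liftFst H s '' f = e} =
        ({liftEdge s e true, liftEdge s e false} : Set (Set (H.V × Bool))) := by
      ext L
      constructor
      · rintro ⟨⟨e', he', b, rfl⟩, h⟩
        rw [image_liftFst] at h
        subst h
        cases b
        · exact Or.inr rfl
        · exact Or.inl rfl
      · rintro (rfl | rfl)
        · exact ⟨⟨e, he, _, rfl⟩, image_liftFst H s e _⟩
        · exact ⟨⟨e, he, _, rfl⟩, image_liftFst H s e _⟩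
    refine (congrArg Set.ncard this).trans (Set.ncard_pair fun h => ?_)
    exact absurd (liftEdge_injective (hH.nonempty_of_mem_edges he) h).2 (by simp)

/-- A hypergraph which covers a regular hypergraph is regular. -/
theorem IsCoveringProjection.isRegular {K : FinHypergraph} {p : K.V → H.V}
    (hp : IsCoveringProjection K H p) (hH : H.IsRegular d r) : K.IsRegular d r := by
  refine ⟨hH.1, fun v => ?_, fun e he => ?_⟩
  · rw [← hH.2.1 (p v), ← (hp.bijOn_edgesAt v).image_eq,
      (hp.bijOn_edgesAt v).injOn.ncard_image]
  · rw [← hH.2.2 _ (hp.map_edge e he), (hp.injOn_edge e he).ncard_image]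

theorem card_lift : Fintype.card (H.lift s).V = 2 * Fintype.card H.V := by
  have : Fintype.card (H.lift s).V = Fintype.card (H.V × Bool) := Fintype.card_congr (Equiv.refl _)
  rw [this, Fintype.card_prod, Fintype.card_bool, mul_comm]

open Classical in
/-- The number of edges through two distinct vertices whose incidence signs differ by `b`. -/
def signedCount (H : FinHypergraph) (s : H.V → Set H.V → Bool) (b : Bool) : Matrix H.V H.V ℝ :=
  of fun u v => if u = v then 0 else
    (({e ∈ H.edges | (u ∈ e ∧ v ∈ e) ∧ (s u e ^^ s v e) = b} : Set (Set H.V)).ncard : ℝ)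

open Classical in
/-- The incidence matrix with signs. -/
def signedIncidence (H : FinHypergraph) (s : H.V → Set H.V → Bool) : Matrix H.V (Set H.V) ℝ :=
  of fun v e => if e ∈ H.edges ∧ v ∈ e then (if s v e then 1 else -1) else 0

/-- A lift of `e` through `(u, i)` must have index `s u e ^^ i`. It also passes through `(v, j)`
exactly when the signs of `u` and `v` on `e` differ by `i ^^ j`. Two points of one fibre never share
an edge. -/
theorem adjMatrix_lift (hH : H.IsRegular d r) (u v : H.V) (i j : Bool) :
    (H.lift s).adjMatrix (u, i) (v, j) = signedCount H s (i ^^ j) u v := by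
  classical
  by_cases huv : u = v
  · subst huv
    have hrhs : signedCount H s (i ^^ j) u u = 0 := by simp [signedCount]
    rw [hrhs]
    by_cases hij : i = j
    · subst hij
      exact if_pos rfl
    · have hempty : ({L ∈ (H.lift s).edges | (u, i) ∈ L ∧ (u, j) ∈ L} : Set (Set (H.V × Bool))) =
          ∅ := by
        ext L
        simp only [Set.mem_ofPred_eq, Set.mem_empty_iff_false, iff_false]
        rintro ⟨⟨e, he, b, rfl⟩, hi, hj⟩
        have := hi.2.trans hj.2.symm
        simp at this
        exact hij this
      have : ({L ∈ (H.lift s).edges | (u, i) ∈ L ∧ (u, j) ∈ L} : Set (Set (H.V × Bool))).ncard =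
          0 := by rw [hempty, Set.ncard_empty]
      have hne : ¬ ((u, i) : H.V × Bool) = (u, j) := by simp [hij]
      refine (if_neg hne).trans ?_
      exact_mod_cast this
  · have hne : ¬ ((u, i) : H.V × Bool) = (v, j) := by simp [huv]
    refine (if_neg hne).trans ?_
    refine Eq.trans ?_ (if_neg huv).symm
    have : ({L ∈ (H.lift s).edges | (u, i) ∈ L ∧ (v, j) ∈ L} : Set (Set (H.V × Bool))) =
        (fun e => liftEdge s e (s u e ^^ i)) ''
          {e ∈ H.edges | (u ∈ e ∧ v ∈ e) ∧ (s u e ^^ s v e) = (i ^^ j)} := by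
      ext L
      constructor
      · rintro ⟨⟨e, he, b, rfl⟩, hu, hv⟩
        refine ⟨e, ⟨he, ⟨hu.1, hv.1⟩, ?_⟩, ?_⟩
        · have h1 := hu.2
          have h2 := hv.2
          simp only at h1 h2
          revert h1 h2
          cases s u e <;> cases s v e <;> cases i <;> cases j <;> cases b <;> simp
        · have h1 := hu.2
          simp only at h1
          simp only [h1]
      · rintro ⟨e, ⟨he, ⟨hu, hv⟩, h⟩, rfl⟩
        refine ⟨⟨e, he, _, rfl⟩, ⟨hu, rfl⟩, ⟨hv, ?_⟩⟩
        simp only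
        revert h
        cases s u e <;> cases s v e <;> cases i <;> cases j <;> simp
    refine congrArg Nat.cast ((congrArg Set.ncard this).trans (Set.InjOn.ncard_image ?_))
    rintro e ⟨he, _⟩ e' _ h
    exact (liftEdge_injective (hH.nonempty_of_mem_edges he) h).1

theorem signedCount_add : signedCount H s false + signedCount H s true = H.adjMatrix := by
  classical
  ext u v
  by_cases huv : u = v
  · simp [signedCount, adjMatrix, huv]
  · simp only [Matrix.add_apply, signedCount, adjMatrix, of_apply, if_neg huv]
    rw [← Nat.cast_add, ← Set.ncard_union_eq]
    · congr 2
      ext e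
      simp only [Set.mem_union, Set.mem_ofPred_eq]
      cases s u e ^^ s v e <;> simp
    · rw [Set.disjoint_left]
      rintro e ⟨_, _, h⟩ ⟨_, _, h'⟩
      rw [h] at h'
      simp at h'

theorem ncard_eq_sum {α : Type*} [Fintype α] (p : α → Prop) [DecidablePred p] :
    (({a | p a} : Set α).ncard : ℝ) = ∑ a, if p a then 1 else 0 := by
  rw [Set.ncard_eq_toFinset_card', Set.toFinset_ofPred, Finset.card_filter]
  push_cast
  rfl

open Classical in
-- An edge through `u ≠ v` contributes the product of its two signs, and each of the `d` edges at
-- `u` contributes `1` to the diagonal.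
theorem signedIncidence_mul_transpose (hH : H.IsRegular d r) :
    signedIncidence H s * (signedIncidence H s)ᵀ =
      signedCount H s false - signedCount H s true + (d : ℝ) • (1 : Matrix H.V H.V ℝ) := by
  ext u v
  rw [mul_apply]
  by_cases huv : u = v
  · subst huv
    have hd := hH.2.1 u
    have h1 := ncard_eq_sum (fun e : Set H.V => e ∈ H.edges ∧ u ∈ e)
    have h2 : ((({e | e ∈ H.edges ∧ u ∈ e} : Set (Set H.V)).ncard : ℕ) : ℝ) = d := by
      exact_mod_cast hd
    rw [h2] at h1
    simp only [signedCount, Matrix.sub_apply, Matrix.add_apply, of_apply, Matrix.smul_apply, one_apply, if_true,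
      sub_zero, zero_add, smul_eq_mul, mul_one, h1]
    refine Finset.sum_congr rfl fun e _ => ?_
    simp only [signedIncidence, transpose_apply, of_apply]
    split_ifs <;> norm_num
  · simp only [signedCount, Matrix.sub_apply, Matrix.add_apply, of_apply, Matrix.smul_apply, one_apply, if_neg huv,
      smul_eq_mul, mul_zero, add_zero]
    rw [ncard_eq_sum, ncard_eq_sum, ← Finset.sum_sub_distrib]
    refine Finset.sum_congr rfl fun e _ => ?_
    simp only [signedIncidence, transpose_apply, of_apply]
    by_cases he : e ∈ H.edges <;> by_cases hu : u ∈ e <;> by_cases hv : v ∈ e <;>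
      cases s u e <;> cases s v e <;> simp [he, hu, hv]

theorem spectrum_eq_roots (H : FinHypergraph) [DecidableEq H.V] :
    H.spectrum = H.adjMatrix.charpoly.roots := by
  unfold spectrum
  congr!

open Classical in
/-- The spectrum of a `2`-lift is the old one together with that of the signed adjacency matrix. -/
theorem spectrum_lift (hH : H.IsRegular d r) : (H.lift s).spectrum = H.spectrum +
    (signedCount H s false - signedCount H s true).charpoly.roots := by
  let ε : H.V ⊕ H.V ≃ (H.lift s).V := (Equiv.boolProdEquivSum H.V).symm.trans (Equiv.prodComm _ _)
  have h1 : (H.lift s).adjMatrix.submatrix ε ε =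
      fromBlocks (signedCount H s false) (signedCount H s true) (signedCount H s true)
        (signedCount H s false) := by
    ext i j
    rcases i with u | u <;> rcases j with v | v <;>
      exact adjMatrix_lift s hH u v _ _
  have h2 : (H.lift s).adjMatrix.charpoly =
      H.adjMatrix.charpoly * (signedCount H s false - signedCount H s true).charpoly := by
    rw [← signedCount_add s, ← charpoly_fromBlocks_swap, ← h1]
    exact (charpoly_reindex ε.symm (H.lift s).adjMatrix).symm
  rw [spectrum_eq_roots, spectrum_eq_roots, h2, Polynomial.roots_mul]
  exact mul_ne_zero (charpoly_monic _).ne_zero (charpoly_monic _).ne_zero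

end FinHypergraph
end

/-! ### Ramanujan covers and towers -/

noncomputable section

namespace FinHypergraph

open Matrix

/-- A regular hypergraph has a signing for which the squared singular values of the
signed incidence matrix are at most `(√(d - 1) + √(r - 1)) ^ 2`. -/
theorem IsRegular.exists_signs {H : FinHypergraph} {d r : ℕ} (hd : 2 ≤ d) (hH : H.IsRegular d r) :
    ∃ s : H.V → Set H.V → Bool, ∀ (μ : ℝ) (f : H.V → ℝ), f ≠ 0 →
      signedIncidence H s *ᵥ ((signedIncidence H s)ᵀ *ᵥ f) = μ • f →
        μ ≤ (√((d : ℝ) - 1) + √((r : ℝ) - 1)) ^ 2 := by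
  classical
  obtain ⟨σ, hσ, h⟩ := exists_bipartite_signs
    (Finset.univ.filter fun p : H.V × Set H.V => p.2 ∈ H.edges ∧ p.1 ∈ p.2) d r hd hH.1
    (by
      intro v
      refine le_of_eq_of_le ?_ (hH.2.1 v).le
      rw [Set.ncard_eq_toFinset_card']
      refine Finset.card_nbij' (fun p => p.2) (fun e => (v, e)) ?_ ?_ ?_ ?_
      · rintro ⟨w, e⟩ h
        simp only [Finset.coe_filter, Finset.mem_filter, Finset.mem_univ, true_and,
          Set.mem_ofPred_eq] at h
        exact Set.mem_toFinset.2 (h.2 ▸ h.1)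
      · intro e he
        have he : e ∈ H.edgesAt v := Set.mem_toFinset.1 (Finset.mem_coe.1 he)
        have he : e ∈ H.edges ∧ v ∈ e := he
        simpa using he
      · rintro ⟨w, e⟩ h
        simp only [Finset.coe_filter, Finset.mem_filter, Finset.mem_univ, true_and,
          Set.mem_ofPred_eq] at h
        simp [h.2]
      · intro e _
        rfl)
    (by
      intro e
      by_cases he : e ∈ H.edges
      · refine le_of_eq_of_le ?_ (hH.2.2 e he).le
        rw [Set.ncard_eq_toFinset_card']
        refine Finset.card_nbij' (fun p => p.1) (fun v => (v, e)) ?_ ?_ ?_ ?_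
        · rintro ⟨w, e'⟩ h
          simp only [Finset.coe_filter, Finset.mem_filter, Finset.mem_univ, true_and,
            Set.mem_ofPred_eq] at h
          simpa [← h.2] using h.1.2
        · intro v hv
          simpa [he] using hv
        · rintro ⟨w, e'⟩ h
          simp only [Finset.coe_filter, Finset.mem_filter, Finset.mem_univ, true_and,
            Set.mem_ofPred_eq] at h
          simp [h.2]
        · intro v _
          rfl
      · refine le_of_eq_of_le ?_ (Nat.zero_le r)
        rw [Finset.card_eq_zero, Finset.filter_eq_empty_iff]
        rintro ⟨w, e'⟩ h rfl
        simp only [Finset.mem_filter, Finset.mem_univ, true_and] at h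
        exact he h.1)
  refine ⟨fun v e => decide (σ v e = 1), h _ fun v e => ?_⟩
  simp only [signedIncidence, of_apply, Finset.mem_filter, Finset.mem_univ, true_and,
    decide_eq_true_eq]
  split_ifs with h1 h2
  · exact h2.symm
  · exact ((hσ v e).resolve_left h2).symm
  · rfl

theorem le_ramanujanBound_of_add_le_sq {d r : ℕ} (hd : 2 ≤ d) (hr : 2 ≤ r) {l : ℝ}
    (h : l + d ≤ (√((d : ℝ) - 1) + √((r : ℝ) - 1)) ^ 2) : l ≤ ramanujanBound d r := by
  have hd' : (2 : ℝ) ≤ d := by exact_mod_cast hd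
  have hr' : (2 : ℝ) ≤ r := by exact_mod_cast hr
  rw [add_sq, Real.sq_sqrt (by linarith), Real.sq_sqrt (by linarith), mul_assoc,
    ← Real.sqrt_mul (by linarith)] at h
  rw [ramanujanBound]
  linarith

/-- With `x = (d-1)(r-1)` the difference of the two sides is `(√x - 1)²`. The hypothesis `5 ≤ d + r`
excludes `d = r = 2`, the only case with `x = 1`. -/
theorem sq_add_sqrt_lt {d r : ℕ} (hd : 2 ≤ d) (hr : 2 ≤ r) (hdr : 5 ≤ d + r) :
    (√((d : ℝ) - 1) + √((r : ℝ) - 1)) ^ 2 < d * r := by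
  have hd' : (2 : ℝ) ≤ d := by exact_mod_cast hd
  have hr' : (2 : ℝ) ≤ r := by exact_mod_cast hr
  have hdr' : (5 : ℝ) ≤ d + r := by exact_mod_cast hdr
  rw [add_sq, Real.sq_sqrt (by linarith), Real.sq_sqrt (by linarith), mul_assoc,
    ← Real.sqrt_mul (by linarith)]
  set x := ((d : ℝ) - 1) * ((r : ℝ) - 1) with hx
  have hx1 : 1 < x := by nlinarith
  have h1 : 1 < √x := Real.lt_sqrt_of_sq_lt (by linarith)
  have h2 := Real.sq_sqrt (show 0 ≤ x by linarith)
  nlinarith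

open Classical in
/-- A `2`-lift of a connected hypergraph is connected unless the trivial eigenvalue is new. -/
theorem IsConnected.lift {H : FinHypergraph} {d r : ℕ} (hc : H.IsConnected) (hH : H.IsRegular d r)
    {s : H.V → Set H.V → Bool} (hs : ∀ f : H.V → ℝ, f ≠ 0 →
      signedIncidence H s *ᵥ ((signedIncidence H s)ᵀ *ᵥ f) ≠ ((d : ℝ) * r) • f) :
    (H.lift s).IsConnected := by
  obtain ⟨⟨v₀⟩, hc⟩ := hc
  refine ⟨⟨(v₀, true)⟩, ?_⟩
  rintro ⟨u, i⟩ ⟨v, j⟩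
  set R : H.V × Bool → Prop :=
    fun p => Relation.ReflTransGen (H.lift s).toHypergraph.Adj (u, i) p with hR
  -- `χ` is the indicator of the component of `(u, i)`, and `f` is its difference between the two
  -- sheets. The signed values of `f` agree along each edge, so `N * Nᵀ` multiplies `f` by `d * r`.
  let χ : H.V → Bool → ℝ := fun v b => if R (v, b) then 1 else 0
  let f : H.V → ℝ := fun v => χ v true - χ v false
  have hadj : ∀ e ∈ H.edges, ∀ b, ∀ v ∈ e, ∀ w ∈ e,
      R (v, s v e ^^ b) → R (w, s w e ^^ b) := by
    intro e he b v hv w hw h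
    refine h.tail ⟨liftEdge s e b, ⟨e, he, b, rfl⟩, ⟨hv, by simp⟩, ⟨hw, by simp⟩⟩
  have hχ : ∀ e ∈ H.edges, ∀ b, ∀ v ∈ e, ∀ w ∈ e, χ v (s v e ^^ b) = χ w (s w e ^^ b) := by
    intro e he b v hv w hw
    have : R (v, s v e ^^ b) ↔ R (w, s w e ^^ b) :=
      ⟨hadj e he b v hv w hw, hadj e he b w hw v hv⟩
    simp only [χ, this]
  have hf : ∀ v e, (if s v e then (1 : ℝ) else -1) * f v =
      χ v (s v e ^^ false) - χ v (s v e ^^ true) := by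
    intro v e
    cases h : s v e <;> simp [f]
  have hNt : ∀ e ∈ H.edges, ∀ v ∈ e, ((signedIncidence H s)ᵀ *ᵥ f) e =
      r * ((if s v e then (1 : ℝ) else -1) * f v) := by
    intro e he v hv
    have h1 : ((signedIncidence H s)ᵀ *ᵥ f) e =
        ∑ w, if w ∈ e then (if s v e then (1 : ℝ) else -1) * f v else 0 := by
      refine Finset.sum_congr rfl fun w _ => ?_
      by_cases hw : w ∈ e
      · rw [if_pos hw, hf v e, hχ e he false v hv w hw, hχ e he true v hv w hw, ← hf w e]
        simp [signedIncidence, he, hw]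
      · simp [signedIncidence, hw]
    have h2 := ncard_eq_sum (fun w : H.V => w ∈ e)
    have h3 : (({w | w ∈ e} : Set H.V).ncard : ℝ) = r := by exact_mod_cast hH.2.2 e he
    rw [h3] at h2
    rw [h1, h2, Finset.sum_mul]
    refine Finset.sum_congr rfl fun w _ => ?_
    split_ifs <;> simp
  have heig : signedIncidence H s *ᵥ ((signedIncidence H s)ᵀ *ᵥ f) = ((d : ℝ) * r) • f := by
    ext v
    have h2 := ncard_eq_sum (fun e : Set H.V => e ∈ H.edges ∧ v ∈ e)
    have h3 : (({e | e ∈ H.edges ∧ v ∈ e} : Set (Set H.V)).ncard : ℝ) = d := by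
      exact_mod_cast hH.2.1 v
    rw [h3] at h2
    rw [Pi.smul_apply, smul_eq_mul, h2, mul_assoc, Finset.sum_mul]
    refine Finset.sum_congr rfl fun e _ => ?_
    by_cases he : e ∈ H.edges ∧ v ∈ e
    · rw [hNt e he.1 v he.2, if_pos he]
      simp only [signedIncidence, of_apply, if_pos he]
      cases s v e <;> simp
    · simp [signedIncidence, he]
  have hf0 : f = 0 := by
    by_contra h
    exact hs f h heig
  -- Since `f = 0`, the component contains both points of a fibre or neither, so walks in `H` lift
  -- to it without regard to sheets.
  have hswap : ∀ w b b', R (w, b) → R (w, b') := by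
    intro w b b' h
    have h1 := congrFun hf0 w
    simp only [f, χ, Pi.zero_apply] at h1
    by_contra h'
    cases b <;> cases b' <;> first | exact h' h | simp [h, h'] at h1
  have hall : ∀ w, Relation.ReflTransGen H.toHypergraph.Adj u w → ∀ b, R (w, b) := by
    intro w hw
    induction hw with
    | refl => exact fun b => hswap u i b Relation.ReflTransGen.refl
    | tail _ h ih =>
      obtain ⟨e, he, hx, hy⟩ := h
      exact fun b => hswap _ _ b (hadj e he false _ hx _ hy (ih _))
  exact hall v (hc u v) j

/-- Every right-sided Ramanujan hypergraph has a right-sided Ramanujan `2`-cover. -/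
theorem IsRightSidedRamanujan.exists_twoCover {H : FinHypergraph} {d r : ℕ} (hd : 2 ≤ d)
    (hdr : 5 ≤ d + r) (hH : H.IsRightSidedRamanujan d r) :
    ∃ K : FinHypergraph, K.IsRightSidedRamanujan d r ∧ K.IsRightSidedRamanujanTwoCover H d r ∧
      Fintype.card K.V = 2 * Fintype.card H.V := by
  classical
  obtain ⟨hc, hreg, hram⟩ := hH
  obtain ⟨s, hs⟩ := hreg.exists_signs hd
  have hnew : ∀ l ∈ (signedCount H s false - signedCount H s true).charpoly.roots,
      l ≤ ramanujanBound d r := by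
    intro l hl
    obtain ⟨f, hf0, hf⟩ := exists_eigenvector_of_mem_roots_charpoly hl
    -- An eigenvalue `l` of the signed adjacency matrix is the eigenvalue `l + d` of `N * Nᵀ`.
    refine le_ramanujanBound_of_add_le_sq hd hreg.1 (hs (l + d) f hf0 ?_)
    rw [mulVec_mulVec, signedIncidence_mul_transpose s hreg, add_mulVec, smul_mulVec, one_mulVec,
      hf, add_smul]
  have hspec := spectrum_lift s hreg
  refine ⟨H.lift s, ⟨?_, ?_, ?_⟩, ⟨hc, hreg, hreg.isCover_lift s, ?_, ?_⟩, card_lift s⟩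
  · exact hc.lift hreg fun f hf h => absurd (hs _ f hf h) (not_le.2 (sq_add_sqrt_lt hd hreg.1 hdr))
  · exact (isCoveringProjection_lift H s).isRegular hreg
  · intro l hl hne
    rw [hspec, Multiset.mem_add] at hl
    rcases hl with hl | hl
    · exact hram l hl hne
    · exact hnew l (by convert hl)
  · rw [hspec]
    exact Multiset.le_add_right _ _
  · intro l hl
    rw [newEigenvalues, hspec, add_tsub_cancel_left] at hl
    exact hnew l (by convert hl)

theorem IsRightSidedRamanujan.exists_tower {H : FinHypergraph} {d r : ℕ} (hd : 2 ≤ d)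
    (hdr : 5 ≤ d + r) (hH : H.IsRightSidedRamanujan d r) :
    ∃ K : ℕ → FinHypergraph, K 0 = H ∧
      (∀ i, (K (i + 1)).IsRightSidedRamanujanTwoCover (K i) d r) ∧
      (∀ i, (K i).IsRightSidedRamanujan d r) ∧
      ∀ i, Fintype.card (K i).V = 2 ^ i * Fintype.card H.V := by
  choose! next hnext using fun (K : FinHypergraph) (hK : K.IsRightSidedRamanujan d r) =>
    hK.exists_twoCover hd hdr
  have hK : ∀ i, (next^[i] H).IsRightSidedRamanujan d r := by
    intro i
    induction i with
    | zero => exact hH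
    | succ i ih =>
      rw [Function.iterate_succ_apply']
      exact (hnext _ ih).1
  refine ⟨fun i => next^[i] H, rfl, fun i => ?_, hK, fun i => ?_⟩
  · simp only [Function.iterate_succ_apply']
    exact (hnext _ (hK i)).2.1
  · induction i with
    | zero => exact (one_mul _).symm
    | succ i ih =>
      simp only [Function.iterate_succ_apply']
      rw [(hnext _ (hK i)).2.2, ih, pow_succ]
      ring

end FinHypergraph
end

/-! ### The starting hypergraphs: complete hypergraphs and affine planes -/

noncomputable section

namespace FinHypergraph

open Matrix

/-- A design in which any two points lie in exactly `c` blocks is right-sided Ramanujan. -/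
theorem IsRegular.isRightSidedRamanujan_of_design {H : FinHypergraph} {d r c : ℕ}
    (hH : H.IsRegular d r) (hV : Nonempty H.V) (hc : 0 < c)
    (hpair : ∀ u v : H.V, u ≠ v → ({e ∈ H.edges | u ∈ e ∧ v ∈ e} : Set (Set H.V)).ncard = c)
    (hcard : c * Fintype.card H.V + d = d * r + c) : H.IsRightSidedRamanujan d r := by
  classical
  refine ⟨⟨hV, fun u v => ?_⟩, hH, fun l hl hne => ?_⟩
  · by_cases huv : u = v
    · subst huv
      exact Relation.ReflTransGen.refl
    · have h := Set.nonempty_of_ncard_ne_zero ((hpair u v huv).trans_ne hc.ne')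
      obtain ⟨e, he, hu, hv⟩ := h
      exact Relation.ReflTransGen.single ⟨e, he, hu, hv⟩
  · rw [spectrum_eq_roots] at hl
    obtain ⟨f, hf0, hf⟩ := exists_eigenvector_of_mem_roots_charpoly hl
    have hA : ∀ u v, H.adjMatrix u v = c - if u = v then (c : ℝ) else 0 := by
      intro u v
      by_cases huv : u = v
      · simp [adjMatrix, huv]
      · simp only [adjMatrix, of_apply, if_neg huv, sub_zero]
        exact_mod_cast hpair u v huv
    -- The adjacency matrix is `c (J - I)`, with `J` the all-ones matrix. Either `∑ f ≠ 0` and `l =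
    -- c (n - 1)`, with `n` the number of vertices, which `hcard` identifies with the trivial
    -- eigenvalue, or `l = -c`.
    have hpt : ∀ v, (l + c) * f v = c * ∑ w, f w := by
      intro v
      have h1 := congrFun hf v
      simp only [mulVec, dotProduct, hA, sub_mul, Finset.sum_sub_distrib, ite_mul, zero_mul,
        Finset.sum_ite_eq, Finset.mem_univ, if_true, ← Finset.mul_sum, Pi.smul_apply,
        smul_eq_mul] at h1
      linarith
    have hsum : (l + c) * ∑ w, f w = Fintype.card H.V * (c * ∑ w, f w) := by
      rw [Finset.mul_sum, Finset.sum_congr rfl fun v _ => hpt v]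
      simp
    have hcard' : (c : ℝ) * Fintype.card H.V + d = d * r + c := by exact_mod_cast hcard
    have hS : ∑ w, f w = 0 := by
      by_contra hS
      have h2 : l + c = Fintype.card H.V * c := by
        apply mul_right_cancel₀ hS
        rw [hsum]
        ring
      exact hne (by linarith)
    obtain ⟨v, hv⟩ := Function.ne_iff.1 hf0
    have h3 := hpt v
    rw [hS, mul_zero, mul_eq_zero] at h3
    have h4 : l = -c := by linarith [h3.resolve_right hv]
    have h5 : (2 : ℝ) ≤ r := by exact_mod_cast hH.1
    have h6 := Real.sqrt_nonneg (((d : ℝ) - 1) * ((r : ℝ) - 1))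
    have h7 : (0 : ℝ) ≤ c := Nat.cast_nonneg c
    rw [ramanujanBound]
    linarith

section Complete

variable {d : ℕ}

theorem mem_edges_complete {e : Set (Fin (d + 1))} :
    e ∈ (complete d).edges ↔ ∃ w, e = {w}ᶜ := by
  have h := Set.ncard_add_ncard_compl e
  rw [Nat.card_fin] at h
  have h1 : e ∈ (complete d).edges ↔ eᶜ.ncard = 1 := by
    change e.ncard = d ↔ _
    omega
  rw [h1, Set.ncard_eq_one]
  exact exists_congr fun w => compl_eq_comm.trans eq_comm

theorem ncard_edges_complete_superset (S : Set (Fin (d + 1))) :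
    ({e ∈ (complete d).edges | S ⊆ e} : Set (Set (Fin (d + 1)))).ncard = d + 1 - S.ncard := by
  have h : ({e ∈ (complete d).edges | S ⊆ e} : Set (Set (Fin (d + 1)))) =
      (fun w => {w}ᶜ) '' Sᶜ := by
    ext e
    constructor
    · rintro ⟨he, hS⟩
      obtain ⟨w, rfl⟩ := mem_edges_complete.1 he
      exact ⟨w, fun hw => hS hw rfl, rfl⟩
    · rintro ⟨w, hw, rfl⟩
      refine ⟨mem_edges_complete.2 ⟨w, rfl⟩, ?_⟩
      rintro x hx rfl
      exact hw hx
  rw [h, Set.ncard_image_of_injective _ (fun a b hab => by simpa using hab), Set.ncard_compl,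
    Nat.card_fin]

theorem isRightSidedRamanujan_complete (hd : 3 ≤ d) : (complete d).IsRightSidedRamanujan d d := by
  refine IsRegular.isRightSidedRamanujan_of_design (c := d - 1) ⟨by omega, ?_, fun e he => he⟩
    ⟨(0 : Fin (d + 1))⟩ (by omega) ?_ ?_
  · intro (v : Fin (d + 1))
    refine (congrArg Set.ncard (Set.ext fun e => and_congr_right fun _ =>
      Set.singleton_subset_iff.symm)).trans ((ncard_edges_complete_superset {v}).trans ?_)
    rw [Set.ncard_singleton, Nat.add_sub_cancel]
  · intro (u : Fin (d + 1)) (v : Fin (d + 1)) huv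
    refine (congrArg Set.ncard (Set.ext fun e => and_congr_right fun _ =>
      Set.pair_subset_iff.symm)).trans ((ncard_edges_complete_superset {u, v}).trans ?_)
    rw [Set.ncard_pair (show @Ne (Fin (d + 1)) u v from huv)]
    omega
  · have h : Fintype.card (complete d).V = d + 1 := Fintype.card_fin (d + 1)
    rw [h]
    obtain ⟨k, rfl⟩ : ∃ k, d = k + 1 := ⟨d - 1, by omega⟩
    simp only [Nat.add_sub_cancel]
    ring

end Complete

section AffinePlane

variable {F : Type} [Field F]

/-- The line through `p` with a given slope, which is `none` for the vertical line. -/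
def lineThrough (p : F × F) : Option F → Set (F × F)
  | none => {z | z.1 = p.1}
  | some m => {z | z.2 - p.2 = m * (z.1 - p.1)}

theorem mem_lineThrough_self (p : F × F) (m : Option F) : p ∈ lineThrough p m := by
  cases m with
  | none => exact rfl
  | some m => change p.2 - p.2 = m * (p.1 - p.1); ring

/-- This is the axiom that two points span one line; it gives both the pair count `c = 1` and the
distinctness of the lines through a point. -/
theorem exists_slope {p q : F × F} (h : p ≠ q) : ∃ m₀, ∀ m, q ∈ lineThrough p m ↔ m = m₀ := by
  by_cases h1 : q.1 = p.1
  · have h2 : q.2 - p.2 ≠ 0 := fun h2 => h (Prod.ext h1.symm (sub_eq_zero.1 h2).symm)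
    refine ⟨none, fun m => ?_⟩
    cases m with
    | none => exact iff_of_true h1 rfl
    | some m =>
      refine iff_of_false (fun hm => h2 ?_) (by simp)
      have hm : q.2 - p.2 = m * (q.1 - p.1) := hm
      rw [hm, h1, sub_self, mul_zero]
  · have h2 : q.1 - p.1 ≠ 0 := sub_ne_zero.2 h1
    refine ⟨some ((q.2 - p.2) / (q.1 - p.1)), fun m => ?_⟩
    cases m with
    | none => exact iff_of_false h1 (by simp)
    | some m =>
      change q.2 - p.2 = m * (q.1 - p.1) ↔ _
      rw [Option.some_inj, eq_div_iff h2, eq_comm]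

theorem lineThrough_injective (p : F × F) : Function.Injective (lineThrough p) := by
  intro m m' h
  have : ∃ q, p ≠ q ∧ q ∈ lineThrough p m := by
    cases m with
    | none => exact ⟨(p.1, p.2 + 1), fun h => by simpa using congrArg Prod.snd h, rfl⟩
    | some m =>
      refine ⟨(p.1 + 1, p.2 + m), fun h => by simpa using congrArg Prod.fst h, ?_⟩
      change p.2 + m - p.2 = m * (p.1 + 1 - p.1)
      ring
  obtain ⟨q, hpq, hq⟩ := this
  obtain ⟨m₀, hm₀⟩ := exists_slope hpq
  rw [(hm₀ m).1 hq, (hm₀ m').1 (h ▸ hq)]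

theorem ncard_lineThrough [Fintype F] (p : F × F) (m : Option F) :
    (lineThrough p m).ncard = Fintype.card F := by
  rw [← Nat.card_eq_fintype_card, ← Set.ncard_univ]
  cases m with
  | none =>
    have h : lineThrough p none = (fun y => (p.1, y)) '' Set.univ := by
      ext ⟨x, y⟩
      simp [lineThrough, eq_comm]
    rw [h, Set.ncard_image_of_injective _ fun a b hab => by simpa using hab]
  | some m =>
    have h : lineThrough p (some m) = (fun x => (x, p.2 + m * (x - p.1))) '' Set.univ := by
      ext ⟨x, y⟩
      simp only [lineThrough, Set.mem_ofPred_eq, Set.image_univ, Set.mem_range, Prod.mk.injEq,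
        exists_eq_left, sub_eq_iff_eq_add']
      exact eq_comm
    rw [h, Set.ncard_image_of_injective _ fun a b hab => congrArg Prod.fst hab]

variable [Fintype F]

theorem lineThrough_mem_edges (p : F × F) (m : Option F) :
    lineThrough p m ∈ (affinePlane F).edges := by
  cases m with
  | none =>
    refine ⟨1, 0, p.1, by simp, ?_⟩
    ext z
    simp [lineThrough]
  | some m =>
    refine ⟨-m, 1, p.2 - m * p.1, by simp, ?_⟩
    ext z
    change z.2 - p.2 = m * (z.1 - p.1) ↔ -m * z.1 + 1 * z.2 = p.2 - m * p.1
    constructor <;> intro h <;> linear_combination h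

theorem exists_eq_lineThrough {L : Set (F × F)} (hL : L ∈ (affinePlane F).edges) {p : F × F}
    (hp : p ∈ L) : ∃ m, lineThrough p m = L := by
  obtain ⟨a, b, c, hab, rfl⟩ := hL
  have hp : a * p.1 + b * p.2 = c := hp
  by_cases hb : b = 0
  · have ha : a ≠ 0 := hab.resolve_right (not_not.2 hb)
    refine ⟨none, ?_⟩
    ext z
    change z.1 = p.1 ↔ a * z.1 + b * z.2 = c
    rw [← hp, hb, zero_mul, zero_mul, add_zero, add_zero, mul_right_inj' ha]
  · refine ⟨some (-a / b), ?_⟩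
    ext z
    change z.2 - p.2 = -a / b * (z.1 - p.1) ↔ a * z.1 + b * z.2 = c
    rw [← hp, div_mul_eq_mul_div, eq_div_iff hb]
    constructor <;> intro h <;> linear_combination h

theorem nonempty_of_mem_edges_affinePlane {L : Set (F × F)} (hL : L ∈ (affinePlane F).edges) :
    L.Nonempty := by
  obtain ⟨a, b, c, ha | hb, rfl⟩ := hL
  · exact ⟨(c / a, 0), by simp [mul_div_cancel₀ c ha]⟩
  · exact ⟨(0, c / b), by simp [mul_div_cancel₀ c hb]⟩

theorem isRightSidedRamanujan_affinePlane :
    (affinePlane F).IsRightSidedRamanujan (Fintype.card F + 1) (Fintype.card F) := by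
  have hq : 2 ≤ Fintype.card F := Fintype.one_lt_card
  refine IsRegular.isRightSidedRamanujan_of_design (c := 1) ⟨hq, ?_, ?_⟩
    ⟨((0, 0) : F × F)⟩ one_pos ?_ ?_
  · intro p
    have h : (affinePlane F).edgesAt p = lineThrough p '' Set.univ := by
      ext L
      constructor
      · rintro ⟨hL, hp⟩
        obtain ⟨m, hm⟩ := exists_eq_lineThrough hL hp
        exact ⟨m, trivial, hm⟩
      · rintro ⟨m, _, rfl⟩
        exact ⟨lineThrough_mem_edges p m, mem_lineThrough_self p m⟩
    rw [h]
    refine (Set.ncard_image_of_injective _ (lineThrough_injective p)).trans ?_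
    rw [Set.ncard_univ, Nat.card_eq_fintype_card, Fintype.card_option]
  · intro L hL
    obtain ⟨p, hp⟩ := nonempty_of_mem_edges_affinePlane hL
    obtain ⟨m, rfl⟩ := exists_eq_lineThrough hL hp
    exact ncard_lineThrough p m
  · intro p q hpq
    obtain ⟨m₀, hm₀⟩ := exists_slope (F := F) hpq
    rw [Set.ncard_eq_one]
    refine ⟨lineThrough p m₀, ?_⟩
    ext L
    constructor
    · rintro ⟨hL, hp, hq⟩
      obtain ⟨m, rfl⟩ := exists_eq_lineThrough hL hp
      exact congrArg (lineThrough p) ((hm₀ m).1 hq)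
    · rintro rfl
      exact ⟨lineThrough_mem_edges p m₀, mem_lineThrough_self p m₀, (hm₀ m₀).2 rfl⟩
  · have h : Fintype.card (affinePlane F).V = Fintype.card F * Fintype.card F :=
      Fintype.card_prod F F
    rw [h]
    ring

end AffinePlane

end FinHypergraph
end

theorem theorem1p4 (d : ℕ) :
    (3 ≤ d → ∃ H : ℕ → FinHypergraph,
      H 0 = FinHypergraph.complete d ∧
      (∀ i, (H (i + 1)).IsRightSidedRamanujanTwoCover (H i) d d) ∧
      (∀ i, (H i).IsRightSidedRamanujan d d) ∧
      (∀ i, Fintype.card (H i).V = 2 ^ i * (d + 1))) ∧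
    (IsPrimePow d → ∃ (F : Type) (_ : Field F) (_ : Fintype F), Fintype.card F = d ∧
      ∃ H : ℕ → FinHypergraph,
        H 0 = FinHypergraph.affinePlane F ∧
        (∀ i, (H (i + 1)).IsRightSidedRamanujanTwoCover (H i) (d + 1) d) ∧
        (∀ i, (H i).IsRightSidedRamanujan (d + 1) d) ∧
        (∀ i, Fintype.card (H i).V = 2 ^ i * d ^ 2)) := by
  constructor
  · intro hd
    obtain ⟨H, h0, hcov, hram, hcard⟩ :=
      (FinHypergraph.isRightSidedRamanujan_complete hd).exists_tower (by omega) (by omega)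
    refine ⟨H, h0, hcov, hram, fun i => (hcard i).trans ?_⟩
    exact congrArg (2 ^ i * ·) (Fintype.card_fin (d + 1))
  · intro hd
    obtain ⟨p, k, hp, hk, rfl⟩ := (isPrimePow_nat_iff d).1 hd
    have : Fact p.Prime := ⟨hp⟩
    let : Fintype (GaloisField p k) := Fintype.ofFinite _
    have hF : Fintype.card (GaloisField p k) = p ^ k := by
      rw [← Nat.card_eq_fintype_card, GaloisField.card p k hk.ne']
    have hq : 2 ≤ p ^ k := hF ▸ Fintype.one_lt_card
    refine ⟨GaloisField p k, inferInstance, inferInstance, hF, ?_⟩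
    have hram₀ := FinHypergraph.isRightSidedRamanujan_affinePlane (F := GaloisField p k)
    rw [hF] at hram₀
    obtain ⟨H, h0, hcov, hram, hcard⟩ := hram₀.exists_tower (by omega) (by omega)
    refine ⟨H, h0, hcov, hram, fun i => (hcard i).trans ?_⟩
    refine congrArg (2 ^ i * ·) ?_
    exact (Fintype.card_prod _ _).trans (by rw [hF, sq])
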